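/- **Theorem.** Let $K$ be a field of characteristic $0$. A *ternary tree* is a rooted plane tree in which every node has either no children (a leaf, written $\ast$) or exactly three children (an internal node); $(xyz)$ denotes the tree whose root has the children $x,y,z$. The *weight* of a tree is its number of internal nodes, its *arity* is its number of leaves, and $t=({\ast}{\ast}{\ast})$. Let $\mathcal{LT}=\bigoplus_n\mathcal{LT}(n)$ be the free nonsymmetric operad over $K$ generated by one ternary operation $t$ of even homological degree: $\mathcal{LT}(n)$ has the ternary trees of arity $n$ as a basis, and $p\circ_i q$ identifies leaf $i$ of $p$ with the root of $q$ (all Koszul signs are $+1$, since the degree of $t$ is even). The ideal $\langle G\rangle$ generated by $G\subseteq\mathcal{LT}$ is the smallest subspace that contains $G$, is homogeneous with respect to arity, and is closed under partial composition with arbitrary elements of $\mathcal{LT}$ on either side. Trees of equal arity $n$ are compared in *path-lex order*: lexicographic order of the sequences $(a_1,\dots,a_n)$, where $a_i$ is the length of the path from the root to leaf $i$. The leading monomial $\ell m(f)$ of a nonzero $f\in\mathcal{LT}(n)$ is the greatest tree occurring in $f$. A tree $p$ divides a tree $q$ if $q$ is obtained from $p$ by a sequence of partial compositions with trees, on either side.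 A *Gröbner basis* of an ideal $I$ is a finite set $G$ of nonzero arity-homogeneous elements with $\langle G\rangle=I$ such that for every nonzero arity-homogeneous $f\in I$ some $\ell m(g)$, $g\in G$, divides $\ell m(f)$. It is *reduced* if all its elements have leading coefficient $1$ and, for distinct $g,h\in G$, no tree occurring in $g$ is divisible by $\ell m(h)$. Let $\alpha=t\circ_1t+t\circ_2t+t\circ_3t=(({\ast}{\ast}{\ast}){\ast}{\ast})+({\ast}({\ast}{\ast}{\ast}){\ast})+({\ast}{\ast}({\ast}{\ast}{\ast}))$. Then the ideal $\langle\alpha\rangle$ has exactly one reduced Gröbner basis for the path-lex order, namely the set $\{\alpha,\beta,\eta,\theta,\nu\}$, which has five elements, where $$\begin{aligned} \beta&=({\ast}({\ast}{\ast}({\ast}{\ast}{\ast})){\ast})+({\ast}{\ast}({\ast}({\ast}{\ast}{\ast}){\ast}))+({\ast}{\ast}({\ast}{\ast}({\ast}{\ast}{\ast}))),\\ \eta&=({\ast}({\ast}{\ast}{\ast})({\ast}({\ast}{\ast}{\ast}){\ast}))+({\ast}({\ast}{\ast}{\ast})({\ast}{\ast}({\ast}{\ast}{\ast}))),\\ \theta&=({\ast}{\ast}({\ast}({\ast}{\ast}{\ast})({\ast}{\ast}{\ast}))),\\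 \nu&=({\ast}{\ast}({\ast}{\ast}({\ast}{\ast}({\ast}{\ast}{\ast})))). \end{aligned}$$ In each of these five elements the leading monomial is the tree written first. -/

import Mathlib

noncomputable section

namespace TernaryOperad

/-- Ternary trees: rooted plane trees in which every node is a leaf or has exactly three children. -/
inductive TTree : Type
  | leaf : TTree
  | node : TTree → TTree → TTree → TTree

namespace TTree

/-- The weight: the number of internal nodes. -/
def weight : TTree → ℕ
  | leaf => 0
  | node a b c => 1 + a.weight + b.weight + c.weight

/-- The arity: the number of leaves. -/
def arity : TTree → ℕ
  | leaf => 1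
  | node a b c => a.arity + b.arity + c.arity

/-- The basic tree `t`, i.e. the ternary operation `(∗∗∗)`. -/
def t : TTree := node leaf leaf leaf

/-- The partial composition `p ∘ᵢ q`: leaf number `i` of `p` is identified with the root of `q`.
Leaves are numbered `1, …, arity p` from left to right; only such `i` are ever used. -/
def comp : TTree → ℕ → TTree → TTree
  | leaf, _, q => q
  | node a b c, i, q =>
      if i ≤ a.arity then node (a.comp i q) b c
      else if i ≤ a.arity + b.arity then node a (b.comp (i - a.arity) q) c
      else node a b (c.comp (i - (a.arity + b.arity)) q)

/-- The number of internal nodes of a tree that come after its leaf number `i` in the left-to-right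
depth-first (preorder) reading of the tree. -/
def nodesAfter : TTree → ℕ → ℕ
  | leaf, _ => 0
  | node a b c, i =>
      if i ≤ a.arity then a.nodesAfter i + b.weight + c.weight
      else if i ≤ a.arity + b.arity then b.nodesAfter (i - a.arity) + c.weight
      else c.nodesAfter (i - (a.arity + b.arity))

/-- The path sequence: entry number `i` is the length of the path from the root to leaf `i`. -/
def path : TTree → List ℕ
  | leaf => [0]
  | node a b c => (a.path ++ b.path ++ c.path).map (fun k => k + 1)

/-- Path-lex order (used for trees of equal arity): `p` precedes `q` if the path sequence of `p`
is lexicographically smaller than that of `q`. -/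
def Precedes (p q : TTree) : Prop := List.Lex (fun a b : ℕ => a < b) p.path q.path

/-- `Divides p q`: the tree `q` is obtained from `p` by a sequence of partial compositions with
other trees, on either side; that is, `p` is a subtree of `q`. -/
inductive Divides (p : TTree) : TTree → Prop
  | refl : Divides p p
  | comp_right (q r : TTree) (i : ℕ) : Divides p q → 1 ≤ i → i ≤ q.arity →
      Divides p (q.comp i r)
  | comp_left (q r : TTree) (j : ℕ) : Divides p q → 1 ≤ j → j ≤ r.arity →
      Divides p (r.comp j q)

end TTree

open TTree

/-- The vector space with basis all ternary trees; its elements are (possibly inhomogeneous)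
tree polynomials. It is the underlying space of the free nonsymmetric operad. -/
abbrev LT (K : Type*) [Field K] : Type _ := TTree →₀ K

/-- A tree, viewed as a tree polynomial. -/
def mono (K : Type*) [Field K] (p : TTree) : LT K := Finsupp.single p 1

/-- The homogeneous component of arity `n`: the span of the trees of arity `n`. -/
def homog (K : Type*) [Field K] (n : ℕ) : Submodule K (LT K) :=
  Finsupp.supported K K {p : TTree | p.arity = n}

/-- The Koszul sign of the composition `p ∘ᵢ q` when the ternary operation has homological degree
`d`. A tree stands for the composite of its internal nodes written in preorder, each of degree `d`.
In `p ∘ᵢ q` the block `q` moves past the nodes of `p` that come after leaf `i`. -/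
def koszulSign (K : Type*) [Field K] (d : ℤ) (p : TTree) (i : ℕ) (q : TTree) : K :=
  (-1 : K) ^ ((d * (p.nodesAfter i : ℤ)) * (d * (q.weight : ℤ)))

/-- Partial composition in the free nonsymmetric operad on one ternary operation of homological
degree `d`: the bilinear extension of the (signed) partial composition of trees. -/
def pcomp {K : Type*} [Field K] (d : ℤ) (f : LT K) (i : ℕ) (g : LT K) : LT K :=
  f.sum fun p a => g.sum fun q b =>
    Finsupp.single (p.comp i q) (koszulSign K d p i q * (a * b))

/-- Operad ideals: homogeneous subspaces that are closed under partial composition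
with arbitrary tree polynomials on both sides. -/
structure IsOperadIdeal {K : Type*} [Field K] (d : ℤ) (S : Submodule K (LT K)) : Prop where
  homogeneous : ∀ f ∈ S, ∀ n : ℕ, f.filter (fun p => p.arity = n) ∈ S
  pcomp_right_mem : ∀ (m n i : ℕ) (f g : LT K), f ∈ S → f ∈ homog K m → g ∈ homog K n →
    1 ≤ i → i ≤ m → pcomp d f i g ∈ S
  pcomp_left_mem : ∀ (m n j : ℕ) (f g : LT K), f ∈ S → f ∈ homog K m → g ∈ homog K n →
    1 ≤ j → j ≤ n → pcomp d g j f ∈ S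

/-- The operad ideal generated by a set: the intersection of all operad ideals containing it. -/
def idealSpan {K : Type*} [Field K] (d : ℤ) (G : Set (LT K)) : Submodule K (LT K) :=
  sInf {S : Submodule K (LT K) | IsOperadIdeal d S ∧ G ⊆ (S : Set (LT K))}

/-- A relation is a nonzero tree polynomial that is homogeneous of some arity. -/
def IsRelation {K : Type*} [Field K] (f : LT K) : Prop :=
  f ≠ 0 ∧ ∃ n : ℕ, f ∈ homog K n

/-- `p` is the leading monomial of `f`: the greatest tree, in path-lex order, among those that
occur in `f` with a nonzero coefficient. -/
def IsLeadingMonomial {K : Type*} [Field K] (f : LT K) (p : TTree) : Prop :=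
  p ∈ f.support ∧ ∀ q ∈ f.support, q ≠ p → Precedes q p

/-- `G` is a Gröbner basis of `I`: a finite set of relations that generates `I` and is such that the
leading monomial of every relation in `I` is divisible by the leading monomial of some element
of `G`. -/
structure IsGroebnerBasis {K : Type*} [Field K] (d : ℤ) (G : Set (LT K))
    (I : Submodule K (LT K)) : Prop where
  finite : G.Finite
  relation : ∀ g ∈ G, IsRelation g
  span_eq : idealSpan d G = I
  divides : ∀ f ∈ I, IsRelation f →
    ∃ p, IsLeadingMonomial f p ∧ ∃ g ∈ G, ∃ q, IsLeadingMonomial g q ∧ Divides q p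

/-- `G` is a reduced Gröbner basis of `I`: its elements are monic, and no tree occurring in an
element `g` of `G` is divisible by the leading monomial of another element `h` of `G`. -/
structure IsReducedGroebnerBasis {K : Type*} [Field K] (d : ℤ) (G : Set (LT K))
    (I : Submodule K (LT K)) : Prop where
  groebner : IsGroebnerBasis d G I
  monic : ∀ g ∈ G, ∀ p, IsLeadingMonomial g p → g p = 1
  reduced : ∀ g ∈ G, ∀ h ∈ G, h ≠ g → ∀ q, IsLeadingMonomial h q →
    ∀ p ∈ g.support, ¬ Divides q p

/-- Partial associativity `α = t ∘₁ t + t ∘₂ t + t ∘₃ t`. -/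
def alpha (K : Type*) [Field K] (d : ℤ) : LT K :=
  pcomp d (mono K t) 1 (mono K t) + pcomp d (mono K t) 2 (mono K t)
    + pcomp d (mono K t) 3 (mono K t)

/-- `((∗∗∗)∗∗)` -/
def alphaLead : TTree := node t leaf leaf

/-- `(∗(∗∗(∗∗∗))∗)` -/
def betaLead : TTree := node leaf (node leaf leaf t) leaf

/-- `(∗(∗∗∗)(∗(∗∗∗)∗))` -/
def etaLead : TTree := node leaf t (node leaf t leaf)

/-- `(∗∗(∗(∗∗∗)(∗∗∗)))` -/
def thetaLead : TTree := node leaf leaf (node leaf t t)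

/-- `(∗∗(∗∗(∗∗(∗∗∗))))` -/
def nuLead : TTree := node leaf leaf (node leaf leaf (node leaf leaf t))

/-- `β = (∗(∗∗(∗∗∗))∗) + (∗∗(∗(∗∗∗)∗)) + (∗∗(∗∗(∗∗∗)))` -/
def beta (K : Type*) [Field K] : LT K :=
  mono K betaLead + mono K (node leaf leaf (node leaf t leaf))
    + mono K (node leaf leaf (node leaf leaf t))

/-- `η = (∗(∗∗∗)(∗(∗∗∗)∗)) + (∗(∗∗∗)(∗∗(∗∗∗)))` -/
def eta (K : Type*) [Field K] : LT K :=
  mono K etaLead + mono K (node leaf t (node leaf leaf t))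

/-- `θ = (∗∗(∗(∗∗∗)(∗∗∗)))` -/
def theta (K : Type*) [Field K] : LT K := mono K thetaLead

/-- `ν = (∗∗(∗∗(∗∗(∗∗∗))))` -/
def nu (K : Type*) [Field K] : LT K := mono K nuLead

end TernaryOperad

end

/-!
The five relations lie in the ideal `⟨α⟩`: each of them is an explicit linear combination of
instances of `α` grafted into trees (`IsOperadIdeal.beta_mem`, `eta_mem`, `theta_mem`, `nu_mem`);
the denominators 2 and 3 occur, which is where characteristic zero enters.

That nothing else is needed is seen without computing S-polynomials, by building the quotient
operad. The trees not divisible by any of the five leading monomials, called normal, form an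
explicit list (`NormalIndex`, `exists_tree_eq`). On the vector space `A` spanned by them a ternary
product is defined by a multiplication table (`normalMul`), which satisfies partial associativity
(`partial_assoc`). This identity needs to be checked on basis elements only, and it is trivial
unless at least three of its five arguments are the single leaf, since products involving two
arguments other than the leaf annihilate `A`. Hence the tree polynomials that vanish under every
evaluation of their leaves in `A` form an operad ideal containing `α`
(`isOperadIdeal_identities`, `idealSpan_alpha_le_identities`).

Evaluating all leaves at the generator of `A` gives a linear map that fixes the normal trees
(`normalForm_tree`) and sends every tree to a combination of normal trees that are not larger in
path-lex order (`normalForm_mem_supported`). If the leading monomial of some `f ∈ ⟨α⟩` were normal,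
its coefficient would survive in the image of `f`, which is zero (`leadingMonomial_ne_tree`). So
the five relations form a Gröbner basis. It is reduced by inspection, and uniqueness is the general
fact that two reduced Gröbner bases of an ideal have the same leading monomials, and that two
elements with the same leading monomial differ by an element of the ideal all of whose trees are
reduced, that is, by zero (`IsReducedGroebnerBasis.subset_of`).
-/

noncomputable section

namespace TernaryOperad

open TTree

/-! ### Trees, grafting and divisibility -/

namespace TTree

theorem arity_pos (p : TTree) : 1 ≤ p.arity := by
  induction p with
  | leaf => simp [arity]
  | node a b c iha _ _ => simp only [arity]; omega

theorem arity_comp (p q : TTree) (i : ℕ) (h1 : 1 ≤ i) (h2 : i ≤ p.arity) :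
    (p.comp i q).arity + 1 = p.arity + q.arity := by
  induction p generalizing i with
  | leaf => simp [comp, arity, add_comm]
  | node a b c iha ihb ihc =>
    simp only [arity] at h2
    simp only [comp]
    split_ifs with ha hb
    · have := iha i h1 ha
      simp only [arity]; omega
    · have := ihb (i - a.arity) (by omega) (by omega)
      simp only [arity]; omega
    · have := ihc (i - (a.arity + b.arity)) (by omega) (by omega)
      simp only [arity]; omega

theorem comp_one_node (a b c : TTree) : (node leaf b c).comp 1 a = node a b c := by
  simp [comp, arity]

theorem comp_two_node (a b c : TTree) : (node a leaf c).comp (a.arity + 1) b = node a b c := by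
  simp [comp, arity]

theorem comp_three_node (a b c : TTree) :
    (node a b leaf).comp (a.arity + b.arity + 1) c = node a b c := by
  have := b.arity_pos
  simp only [comp]
  rw [if_neg (by omega), if_neg (by omega)]

theorem Divides.trans {p q r : TTree} (h : Divides p q) (h' : Divides q r) : Divides p r := by
  induction h' with
  | refl => exact h
  | comp_right q r i _ h1 h2 ih => exact .comp_right _ _ _ ih h1 h2
  | comp_left q r i _ h1 h2 ih => exact .comp_left _ _ _ ih h1 h2

theorem eq_leaf_of_arity_le_one {p : TTree} (h : p.arity ≤ 1) : p = leaf := by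
  cases p with
  | leaf => rfl
  | node a b c =>
    have := a.arity_pos
    have := b.arity_pos
    simp only [arity] at h
    have := c.arity_pos
    omega

theorem comp_leaf (p : TTree) (i : ℕ) : p.comp i leaf = p := by
  induction p generalizing i with
  | leaf => rfl
  | node a b c iha ihb ihc => simp only [comp, iha, ihb, ihc, ite_self]

theorem Divides.arity_le {p q : TTree} (h : Divides p q) : p.arity ≤ q.arity := by
  induction h with
  | refl => exact le_rfl
  | comp_right q r i _ h1 h2 ih =>
    have := arity_comp q r i h1 h2
    have := r.arity_pos
    omega
  | comp_left q r i _ h1 h2 ih =>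
    have := arity_comp r q i h1 h2
    have := r.arity_pos
    omega

/-- Proper division increases the arity, since a composition has the arity of one factor only if the
other factor is a leaf. -/
theorem Divides.eq_of_arity_le {p q : TTree} (h : Divides p q) (hle : q.arity ≤ p.arity) :
    p = q := by
  induction h with
  | refl => rfl
  | comp_right q r i hq h1 h2 ih =>
    have := arity_comp q r i h1 h2
    have := hq.arity_le
    rw [eq_leaf_of_arity_le_one (show r.arity ≤ 1 by omega), comp_leaf]
    exact ih (by have := r.arity_pos; omega)
  | comp_left q r i hq h1 h2 ih =>
    have := arity_comp r q i h1 h2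
    have := hq.arity_le
    rw [eq_leaf_of_arity_le_one (show r.arity ≤ 1 by omega), comp]
    exact ih (by have := r.arity_pos; omega)

theorem Divides.antisymm {p q : TTree} (h : Divides p q) (h' : Divides q p) : p = q :=
  h.eq_of_arity_le h'.arity_le

theorem Divides.node_left {p a : TTree} (h : Divides p a) (b c : TTree) :
    Divides p (node a b c) := by
  rw [← comp_one_node]
  exact .comp_left _ _ _ h le_rfl (arity_pos _)

theorem Divides.node_mid {p b : TTree} (h : Divides p b) (a c : TTree) :
    Divides p (node a b c) := by
  rw [← comp_two_node]
  exact .comp_left _ _ _ h (by omega) (by simp only [arity]; omega)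

theorem Divides.node_right {p c : TTree} (h : Divides p c) (a b : TTree) :
    Divides p (node a b c) := by
  rw [← comp_three_node]
  exact .comp_left _ _ _ h (by omega) (by simp only [arity]; omega)

/-- `p.Fits q`: the tree `p` is a subtree of `q` with the same root, i.e. `q` arises from `p` by
grafting trees onto its leaves. -/
def Fits : TTree → TTree → Bool
  | leaf, _ => true
  | node _ _ _, leaf => false
  | node a b c, node a' b' c' => Fits a a' && Fits b b' && Fits c c'

/-- Divisibility as a recursive test: `p` is a top part of `q` or occurs in a child of `q`. -/
def Occurs (p : TTree) : TTree → Bool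
  | leaf => Fits p leaf
  | node a b c => Fits p (node a b c) || Occurs p a || Occurs p b || Occurs p c

/-- Iterated grafting onto leaves: the reflexive transitive closure of `q ↦ q ∘ᵢ r`. -/
inductive Grows (p : TTree) : TTree → Prop
  | refl : Grows p p
  | graft (q r : TTree) (i : ℕ) : Grows p q → 1 ≤ i → i ≤ q.arity → Grows p (q.comp i r)

theorem Grows.divides {p q : TTree} (h : Grows p q) : Divides p q := by
  induction h with
  | refl => exact .refl
  | graft q r i _ h1 h2 ih => exact .comp_right _ _ _ ih h1 h2

theorem Grows.trans {p q r : TTree} (h : Grows p q) (h' : Grows q r) : Grows p r := by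
  induction h' with
  | refl => exact h
  | graft q r i _ h1 h2 ih => exact .graft _ _ _ ih h1 h2

theorem Grows.node_left {a a' : TTree} (h : Grows a a') (b c : TTree) :
    Grows (node a b c) (node a' b c) := by
  induction h with
  | refl => exact .refl
  | graft q r i _ h1 h2 ih =>
    have := Grows.graft _ r i ih h1 (by simp only [arity]; omega)
    rwa [comp, if_pos h2] at this

theorem Grows.node_mid {b b' : TTree} (h : Grows b b') (a c : TTree) :
    Grows (node a b c) (node a b' c) := by
  induction h with
  | refl => exact .refl
  | graft q r i _ h1 h2 ih =>
    have := Grows.graft _ r (a.arity + i) ih (by omega) (by simp only [arity]; omega)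
    rwa [comp, if_neg (by omega), if_pos (by omega), Nat.add_sub_cancel_left] at this

theorem Grows.node_right {c c' : TTree} (h : Grows c c') (a b : TTree) :
    Grows (node a b c) (node a b c') := by
  induction h with
  | refl => exact .refl
  | graft q r i _ h1 h2 ih =>
    have := Grows.graft _ r (a.arity + b.arity + i) ih (by omega) (by simp only [arity]; omega)
    rwa [comp, if_neg (by omega), if_neg (by omega), Nat.add_sub_cancel_left] at this

theorem grows_of_fits {p q : TTree} (h : p.Fits q = true) : Grows p q := by
  induction p generalizing q with
  | leaf => exact Grows.graft leaf q 1 .refl le_rfl le_rfl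
  | node a b c iha ihb ihc =>
    cases q with
    | leaf => simp [Fits] at h
    | node a' b' c' =>
      simp only [Fits, Bool.and_eq_true] at h
      exact (((iha h.1.1).node_left b c).trans ((ihb h.1.2).node_mid a' c)).trans
        ((ihc h.2).node_right a' b')

theorem divides_of_occurs {p q : TTree} (h : p.Occurs q = true) : Divides p q := by
  induction q with
  | leaf => exact (grows_of_fits h).divides
  | node a b c iha ihb ihc =>
    simp only [Occurs, Bool.or_eq_true] at h
    rcases h with ((h | h) | h) | h
    · exact (grows_of_fits h).divides
    · exact (iha h).node_left _ _
    · exact (ihb h).node_mid _ _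
    · exact (ihc h).node_right _ _

theorem fits_refl (p : TTree) : p.Fits p = true := by
  induction p <;> simp_all [Fits]

theorem Fits.comp {p q : TTree} (h : p.Fits q = true) (i : ℕ) (r : TTree) :
    p.Fits (q.comp i r) = true := by
  induction q generalizing p i with
  | leaf =>
    cases p with
    | leaf => simp [Fits]
    | node => simp [Fits] at h
  | node a b c iha ihb ihc =>
    cases p with
    | leaf => simp [Fits]
    | node a' b' c' =>
      simp only [Fits, Bool.and_eq_true] at h
      simp only [TTree.comp]
      split_ifs <;> simp [Fits, h, iha h.1.1, ihb h.1.2, ihc h.2]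

theorem occurs_of_fits {p q : TTree} (h : p.Fits q = true) : p.Occurs q = true := by
  cases q <;> simp [Occurs, h]

theorem occurs_comp_right {p q : TTree} (h : p.Occurs q = true) (i : ℕ) (r : TTree) :
    p.Occurs (q.comp i r) = true := by
  induction q generalizing i with
  | leaf => exact occurs_of_fits (Fits.comp h i r)
  | node a b c iha ihb ihc =>
    simp only [Occurs, Bool.or_eq_true] at h
    rcases h with ((h | h) | h) | h
    · exact occurs_of_fits (Fits.comp h i r)
    all_goals
      simp only [TTree.comp]
      split_ifs <;> simp [Occurs, h, iha, ihb, ihc]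

theorem occurs_comp_left {p q : TTree} (h : p.Occurs q = true) (j : ℕ) (r : TTree) :
    p.Occurs (r.comp j q) = true := by
  induction r generalizing j with
  | leaf => exact h
  | node a b c iha ihb ihc =>
    simp only [TTree.comp]
    split_ifs <;> simp [Occurs, iha, ihb, ihc]

theorem divides_iff_occurs {p q : TTree} : Divides p q ↔ p.Occurs q = true := by
  refine ⟨fun h => ?_, divides_of_occurs⟩
  induction h with
  | refl => exact occurs_of_fits (fits_refl p)
  | comp_right q r i _ _ _ ih => exact occurs_comp_right ih i r
  | comp_left q r j _ _ _ ih => exact occurs_comp_left ih j r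

/-! ### Path-lex order -/

theorem length_path (p : TTree) : p.path.length = p.arity := by
  induction p with
  | leaf => rfl
  | node a b c iha ihb ihc => simp [path, arity, iha, ihb, ihc]; omega

theorem node_path_append_ne (a b c : TTree) (k : ℕ) (l m : List ℕ) :
    (node a b c).path.map (· + k) ++ l ≠ k :: m := by
  intro h
  have hl : (node a b c).path ≠ [] := by
    rw [← List.length_pos_iff, length_path]
    exact arity_pos _
  obtain ⟨x, xs, hx⟩ := List.exists_cons_of_ne_nil hl
  have hx0 : x ∈ (node a b c).path := by simp [hx]
  simp only [path, List.mem_map] at hx0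
  obtain ⟨y, _, hy⟩ := hx0
  rw [hx, List.map_cons, List.cons_append, List.cons.injEq] at h
  omega

/-- The path sequences, shifted by the depth of the root, form a prefix code. -/
theorem path_append_inj (p q : TTree) (k : ℕ) (l m : List ℕ)
    (h : p.path.map (· + k) ++ l = q.path.map (· + k) ++ m) : p = q ∧ l = m := by
  induction p generalizing q k l m with
  | leaf =>
    cases q with
    | leaf => simpa [path] using h
    | node a b c => exact absurd (by simpa [path] using h.symm) (node_path_append_ne a b c k m l)
  | node a b c iha ihb ihc =>
    cases q with
    | leaf => exact absurd (by simpa [path] using h) (node_path_append_ne a b c k l m)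
    | node a' b' c' =>
      have hk : ((fun x => x + k) ∘ fun x => x + 1) = fun x : ℕ => x + (1 + k) := by
        funext x; simp only [Function.comp]; omega
      simp only [path, List.map_map, hk, List.map_append, List.append_assoc] at h
      obtain ⟨ha, h₁⟩ := iha _ _ _ _ h
      obtain ⟨hb, h₂⟩ := ihb _ _ _ _ h₁
      obtain ⟨hc, h₃⟩ := ihc _ _ _ _ h₂
      exact ⟨by rw [ha, hb, hc], h₃⟩

theorem path_injective : Function.Injective path := fun p q h =>
  (path_append_inj p q 0 [] [] (by simp [h])).1

theorem precedes_iff {p q : TTree} : Precedes p q ↔ p.path < q.path := Iff.rfl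

theorem Precedes.asymm {p q : TTree} (h : Precedes p q) : ¬ Precedes q p :=
  lt_asymm (precedes_iff.1 h)

/-- Unlike for general lists, a strict inequality between lists of equal length survives appending
arbitrary tails. -/
theorem lex_append {l l' : List ℕ} (h : l < l') (hlen : l.length = l'.length) (s s' : List ℕ) :
    l ++ s < l' ++ s' := by
  induction l generalizing l' with
  | nil => cases l' with
    | nil => exact absurd h (lt_irrefl _)
    | cons => simp at hlen
  | cons x xs ih => cases l' with
    | nil => simp at hlen
    | cons y ys =>
      rw [List.cons_append, List.cons_append, List.cons_lt_cons_iff]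
      rw [List.cons_lt_cons_iff] at h
      exact h.imp_right fun h => ⟨h.1, ih h.2 (by simpa using hlen)⟩

theorem lex_append_left {l l' : List ℕ} (h : l < l') (s : List ℕ) : s ++ l < s ++ l' := by
  induction s with
  | nil => exact h
  | cons x xs ih => exact List.cons_lt_cons_iff.2 (.inr ⟨rfl, ih⟩)

theorem lex_map_succ {l l' : List ℕ} (h : l < l') :
    l.map (fun k => k + 1) < l'.map (fun k => k + 1) :=
  List.map_lt (fun _ _ h => Nat.succ_lt_succ h) h

/-- The weak path-lex order on trees of the same arity. -/
def WeakLE (p q : TTree) : Prop := p.arity = q.arity ∧ p.path ≤ q.path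

theorem WeakLE.refl (p : TTree) : WeakLE p p := ⟨rfl, le_rfl⟩

theorem WeakLE.trans {p q r : TTree} (h : WeakLE p q) (h' : WeakLE q r) : WeakLE p r :=
  ⟨h.1.trans h'.1, h.2.trans h'.2⟩

/-- Grafting into a fixed corolla is monotone, which makes path-lex a monomial order. -/
theorem WeakLE.node {a b c a' b' c' : TTree} (ha : WeakLE a a') (hb : WeakLE b b')
    (hc : WeakLE c c') : WeakLE (node a b c) (node a' b' c') := by
  refine ⟨by simp only [arity, ha.1, hb.1, hc.1], ?_⟩
  have app : ∀ {l l' s s' : List ℕ}, l ≤ l' → l.length = l'.length → s ≤ s' →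
      l ++ s ≤ l' ++ s' := by
    intro l l' s s' h hlen hs
    rcases h.lt_or_eq with h | rfl
    · exact (lex_append h hlen s s').le
    · rcases hs.lt_or_eq with hs | rfl
      · exact (lex_append_left hs l).le
      · exact le_rfl
  have h := app (app ha.2 (by simp only [length_path, ha.1]) hb.2)
    (by simp only [List.length_append, length_path, ha.1, hb.1]) hc.2
  simp only [path]
  rcases h.lt_or_eq with h | h
  · exact (lex_map_succ h).le
  · rw [h]

/-- The depth of the first leaf decides the order. -/
theorem weakLE_of_leaf_node {b c b' c' x y z : TTree}
    (h : (TTree.node leaf b c).arity = (TTree.node (TTree.node x y z) b' c').arity) :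
    WeakLE (TTree.node leaf b c) (TTree.node (TTree.node x y z) b' c') := by
  refine ⟨h, le_of_lt ?_⟩
  have hl : x.path ≠ [] := by
    rw [← List.length_pos_iff, length_path]
    exact arity_pos _
  obtain ⟨u, us, hx⟩ := List.exists_cons_of_ne_nil hl
  simp [path, hx, List.cons_lt_cons_iff]

/-- If the first child is a leaf on both sides, the depth of the second leaf decides. -/
theorem weakLE_of_leaf_leaf_node {c c' x y z : TTree}
    (h : (TTree.node leaf leaf c).arity = (TTree.node leaf (TTree.node x y z) c').arity) :
    WeakLE (TTree.node leaf leaf c) (TTree.node leaf (TTree.node x y z) c') := by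
  refine ⟨h, le_of_lt ?_⟩
  have hl : x.path ≠ [] := by
    rw [← List.length_pos_iff, length_path]
    exact arity_pos _
  obtain ⟨u, us, hx⟩ := List.exists_cons_of_ne_nil hl
  simp [path, hx, List.cons_lt_cons_iff]

end TTree

/-! ### Partial composition in even degree -/

theorem TTree.comp_leaf_left (i : ℕ) (q : TTree) : leaf.comp i q = q := rfl

theorem TTree.comp_of_le {a b c : TTree} {i : ℕ} (h : i ≤ a.arity) (q : TTree) :
    (node a b c).comp i q = node (a.comp i q) b c := by
  rw [comp, if_pos h]

theorem TTree.comp_of_lt_of_le {a b c : TTree} {i : ℕ} (h : a.arity < i)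
    (h' : i ≤ a.arity + b.arity) (q : TTree) :
    (node a b c).comp i q = node a (b.comp (i - a.arity) q) c := by
  rw [comp, if_neg (by omega), if_pos h']

theorem TTree.comp_of_lt {a b c : TTree} {i : ℕ} (h : a.arity + b.arity < i) (q : TTree) :
    (node a b c).comp i q = node a b (c.comp (i - (a.arity + b.arity)) q) := by
  rw [comp, if_neg (by omega), if_neg (by omega)]

section Composition

variable {K : Type*} [Field K] {d : ℤ}

theorem koszulSign_of_even (hd : Even d) (p q : TTree) (i : ℕ) : koszulSign K d p i q = 1 :=
  ((hd.mul_right _).mul_right _).neg_one_zpow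

theorem pcomp_single (hd : Even d) (p q : TTree) (i : ℕ) (a b : K) :
    pcomp d (Finsupp.single p a) i (Finsupp.single q b) = Finsupp.single (p.comp i q) (a * b) := by
  simp [pcomp, koszulSign_of_even hd]

theorem pcomp_mono (hd : Even d) (p q : TTree) (i : ℕ) :
    pcomp d (mono K p) i (mono K q) = mono K (p.comp i q) := by
  simp [mono, pcomp_single hd]

theorem pcomp_add_left (f f' : LT K) (i : ℕ) (g : LT K) :
    pcomp d (f + f') i g = pcomp d f i g + pcomp d f' i g := by
  unfold pcomp
  refine Finsupp.sum_add_index' (by simp) fun p a a' => ?_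
  rw [← Finsupp.sum_add]
  refine Finsupp.sum_congr fun q _ => ?_
  rw [← Finsupp.single_add, add_mul, mul_add]

theorem pcomp_add_right (f : LT K) (i : ℕ) (g g' : LT K) :
    pcomp d f i (g + g') = pcomp d f i g + pcomp d f i g' := by
  unfold pcomp
  rw [← Finsupp.sum_add]
  refine Finsupp.sum_congr fun p _ => Finsupp.sum_add_index' (by simp) fun q b b' => ?_
  rw [← Finsupp.single_add, mul_add, mul_add]

theorem mono_mem_homog {p : TTree} {n : ℕ} (h : p.arity = n) : mono K p ∈ homog K n :=
  Finsupp.single_mem_supported K 1 h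

theorem arity_eq_of_mem_homog {f : LT K} {n : ℕ} (hf : f ∈ homog K n) {p : TTree} (hp : f p ≠ 0) :
    p.arity = n :=
  (Finsupp.mem_supported K f).1 hf (Finsupp.mem_support_iff.2 hp)

theorem pcomp_mem_homog {f g : LT K} {m n i : ℕ} (hf : f ∈ homog K m) (hg : g ∈ homog K n)
    (h1 : 1 ≤ i) (h2 : i ≤ m) : pcomp d f i g ∈ homog K (m + n - 1) := by
  refine Submodule.sum_mem _ fun p hp => Submodule.sum_mem _ fun q hq =>
    Finsupp.single_mem_supported K _ ?_
  have hp := arity_eq_of_mem_homog hf (Finsupp.mem_support_iff.1 hp)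
  have hq := arity_eq_of_mem_homog hg (Finsupp.mem_support_iff.1 hq)
  have := arity_comp p q i h1 (hp ▸ h2)
  rw [Set.mem_ofPred_eq]
  omega

theorem pcomp_mono_left (hd : Even d) (p : TTree) (i : ℕ) (f : LT K) :
    pcomp d (mono K p) i f = f.mapDomain (fun q => p.comp i q) := by
  induction f using Finsupp.induction_linear with
  | zero => simp [pcomp]
  | add f g hf hg => rw [pcomp_add_right, hf, hg, Finsupp.mapDomain_add]
  | single q b => rw [mono, pcomp_single hd, Finsupp.mapDomain_single, one_mul]

/-- Grafting a tree polynomial as first child of a node with further children `b`, `c`. -/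
def nodeLeft (b c : TTree) : LT K →ₗ[K] LT K := Finsupp.lmapDomain K K fun a => node a b c

/-- Grafting a tree polynomial as second child of a node with further children `a`, `c`. -/
def nodeMid (a c : TTree) : LT K →ₗ[K] LT K := Finsupp.lmapDomain K K fun b => node a b c

/-- Grafting a tree polynomial as third child of a node with further children `a`, `b`. -/
def nodeRight (a b : TTree) : LT K →ₗ[K] LT K := Finsupp.lmapDomain K K fun c => node a b c

@[simp] theorem nodeLeft_mono (a b c : TTree) : nodeLeft b c (mono K a) = mono K (node a b c) := by
  simp [nodeLeft, mono]

@[simp] theorem nodeMid_mono (a b c : TTree) : nodeMid a c (mono K b) = mono K (node a b c) := by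
  simp [nodeMid, mono]

@[simp] theorem nodeRight_mono (a b c : TTree) :
    nodeRight a b (mono K c) = mono K (node a b c) := by
  simp [nodeRight, mono]

theorem alpha_eq (hd : Even d) : alpha K d = mono K (node t leaf leaf) +
    mono K (node leaf t leaf) + mono K (node leaf leaf t) := by
  simp [alpha, pcomp_mono hd, t, comp, arity]

theorem alpha_mem_homog (hd : Even d) : alpha K d ∈ homog K 5 := by
  rw [alpha_eq hd]
  refine Submodule.add_mem _ (Submodule.add_mem _ ?_ ?_) ?_ <;> exact mono_mem_homog rfl

theorem beta_mem_homog : beta K ∈ homog K 7 := by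
  refine Submodule.add_mem _ (Submodule.add_mem _ ?_ ?_) ?_ <;> exact mono_mem_homog rfl

theorem eta_mem_homog : eta K ∈ homog K 9 := by
  refine Submodule.add_mem _ ?_ ?_ <;> exact mono_mem_homog rfl

theorem theta_mem_homog : theta K ∈ homog K 9 := mono_mem_homog rfl

theorem nu_mem_homog : nu K ∈ homog K 9 := mono_mem_homog rfl

end Composition

/-! ### Consequences of partial associativity in an operad ideal -/

section Ideal

variable {K : Type*} [Field K] {d : ℤ} {S : Submodule K (LT K)}

/-- The homogeneous elements of a subspace of tree polynomials. -/
def HomogIn (S : Submodule K (LT K)) (f : LT K) : Prop := f ∈ S ∧ ∃ n, f ∈ homog K n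

theorem IsOperadIdeal.graft_left (hS : IsOperadIdeal d S) {f : LT K} (hf : HomogIn S f)
    (p : TTree) (j : ℕ) (h1 : 1 ≤ j) (h2 : j ≤ p.arity) :
    HomogIn S (pcomp d (mono K p) j f) := by
  obtain ⟨hfS, n, hn⟩ := hf
  exact ⟨hS.pcomp_left_mem _ _ _ _ _ hfS hn (mono_mem_homog rfl) h1 h2,
    _, pcomp_mem_homog (mono_mem_homog rfl) hn h1 h2⟩

theorem IsOperadIdeal.graft_right (hS : IsOperadIdeal d S) {f : LT K} {n : ℕ}
    (hf : f ∈ S ∧ f ∈ homog K n) (p : TTree) (i : ℕ) (h1 : 1 ≤ i) (h2 : i ≤ n) :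
    pcomp d f i (mono K p) ∈ S ∧ pcomp d f i (mono K p) ∈ homog K (n + p.arity - 1) :=
  ⟨hS.pcomp_right_mem _ _ _ _ _ hf.1 hf.2 (mono_mem_homog rfl) h1 h2,
    pcomp_mem_homog hf.2 (mono_mem_homog rfl) h1 h2⟩

theorem IsOperadIdeal.nodeLeft (hS : IsOperadIdeal d S) (hd : Even d) (b c : TTree) {f : LT K}
    (hf : HomogIn S f) : HomogIn S (nodeLeft b c f) := by
  have := hS.graft_left hf (node leaf b c) 1 le_rfl (arity_pos _)
  rwa [pcomp_mono_left hd, funext fun q => comp_one_node q b c] at this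

theorem IsOperadIdeal.nodeMid (hS : IsOperadIdeal d S) (hd : Even d) (a c : TTree) {f : LT K}
    (hf : HomogIn S f) : HomogIn S (nodeMid a c f) := by
  have := hS.graft_left hf (node a leaf c) (a.arity + 1) (by omega) (by simp only [arity]; omega)
  rwa [pcomp_mono_left hd, funext fun q => comp_two_node a q c] at this

theorem IsOperadIdeal.nodeRight (hS : IsOperadIdeal d S) (hd : Even d) (a b : TTree) {f : LT K}
    (hf : HomogIn S f) : HomogIn S (nodeRight a b f) := by
  have := hS.graft_left hf (node a b leaf) (a.arity + b.arity + 1) (by omega)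
    (by simp only [arity]; omega)
  rwa [pcomp_mono_left hd, funext fun q => comp_three_node a b q] at this

/-- An operad ideal containing `α` contains every instance of the partial associativity relation,
because trees can be grafted onto all five leaves of `α`. -/
theorem IsOperadIdeal.alpha_instance (hS : IsOperadIdeal d S) (hd : Even d) (hα : alpha K d ∈ S)
    (x y z u v : TTree) :
    HomogIn S (mono K (node (node x y z) u v) + mono K (node x (node y z u) v) +
      mono K (node x y (node z u v))) := by
  have h0 := And.intro hα (alpha_mem_homog (K := K) hd)
  -- Grafting from right to left keeps the numbers of the remaining leaves.
  have h5 := hS.graft_right h0 v 5 (by omega) (by omega)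
  have h4 := hS.graft_right h5 u 4 (by omega) (by omega)
  have h3 := hS.graft_right h4 z 3 (by omega) (by omega)
  have h2 := hS.graft_right h3 y 2 (by omega) (by omega)
  have h1 := hS.graft_right h2 x 1 (by omega) (by omega)
  have key : pcomp d (pcomp d (pcomp d (pcomp d (pcomp d (alpha K d) 5 (mono K v))
      4 (mono K u)) 3 (mono K z)) 2 (mono K y)) 1 (mono K x) = mono K (node (node x y z) u v) +
      mono K (node x (node y z u) v) + mono K (node x y (node z u v)) := by
    simp (disch := simp only [arity]; omega) only [alpha_eq hd, pcomp_add_left, pcomp_mono hd, t,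
      comp_leaf_left, comp_of_le, comp_of_lt_of_le, comp_of_lt, arity, Nat.reduceAdd, Nat.reduceSub]
  rw [key] at h1
  exact ⟨h1.1, _, h1.2⟩

/-- `β` arises at weight 3, from the overlap of `((∗∗∗)∗∗)` with itself. The instances of `α`
involved and the coefficients come from solving a linear system in the span of the ternary trees of
weight 3. -/
theorem IsOperadIdeal.beta_mem [CharZero K] (hS : IsOperadIdeal d S) (hd : Even d)
    (hα : alpha K d ∈ S) : beta K ∈ S := by
  have h := hS.alpha_instance hd hα
  have h1 := h leaf leaf leaf t leaf
  have h2 := h leaf leaf t leaf leaf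
  have h3 := hS.nodeRight hd leaf leaf (h leaf leaf leaf leaf leaf)
  have h4 := h leaf t leaf leaf leaf
  have h5 := h leaf leaf leaf leaf t
  have h6 := h t leaf leaf leaf leaf
  have h7 := hS.nodeLeft hd leaf leaf (h leaf leaf leaf leaf leaf)
  have h8 := hS.nodeMid hd leaf leaf (h leaf leaf leaf leaf leaf)
  have key :=
    S.add_mem (S.smul_mem (1/2 : K) h1.1) <|
    S.add_mem (S.smul_mem (-1/2 : K) h2.1) <|
    S.add_mem (S.smul_mem (1/2 : K) h3.1) <|
    S.add_mem (S.smul_mem (-1/2 : K) h4.1) <|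
    S.add_mem (S.smul_mem (1/2 : K) h5.1) <|
    S.add_mem (S.smul_mem (-1/2 : K) h6.1) <|
    S.add_mem (S.smul_mem (1/2 : K) h7.1) <|
    S.smul_mem (1/2 : K) h8.1
  convert key using 1
  simp only [beta, betaLead, t, map_add, nodeLeft_mono, nodeMid_mono, nodeRight_mono]
  module

/-- Grafting trees onto all seven leaves of `β`, again from right to left. -/
theorem IsOperadIdeal.beta_instance (hS : IsOperadIdeal d S) (hd : Even d) (hβ : beta K ∈ S)
    (x₁ x₂ x₃ x₄ x₅ x₆ x₇ : TTree) :
    HomogIn S (mono K (node x₁ (node x₂ x₃ (node x₄ x₅ x₆)) x₇) +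
      mono K (node x₁ x₂ (node x₃ (node x₄ x₅ x₆) x₇)) +
      mono K (node x₁ x₂ (node x₃ x₄ (node x₅ x₆ x₇)))) := by
  have h0 := And.intro hβ (beta_mem_homog (K := K))
  have h7 := hS.graft_right h0 x₇ 7 (by omega) (by omega)
  have h6 := hS.graft_right h7 x₆ 6 (by omega) (by omega)
  have h5 := hS.graft_right h6 x₅ 5 (by omega) (by omega)
  have h4 := hS.graft_right h5 x₄ 4 (by omega) (by omega)
  have h3 := hS.graft_right h4 x₃ 3 (by omega) (by omega)
  have h2 := hS.graft_right h3 x₂ 2 (by omega) (by omega)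
  have h1 := hS.graft_right h2 x₁ 1 (by omega) (by omega)
  have key : pcomp d (pcomp d (pcomp d (pcomp d (pcomp d (pcomp d (pcomp d (beta K) 7 (mono K x₇))
      6 (mono K x₆)) 5 (mono K x₅)) 4 (mono K x₄)) 3 (mono K x₃)) 2 (mono K x₂)) 1 (mono K x₁) =
      mono K (node x₁ (node x₂ x₃ (node x₄ x₅ x₆)) x₇) +
      mono K (node x₁ x₂ (node x₃ (node x₄ x₅ x₆) x₇)) +
      mono K (node x₁ x₂ (node x₃ x₄ (node x₅ x₆ x₇))) := by
    simp (disch := simp only [arity]; omega) only [beta, betaLead, pcomp_add_left, pcomp_mono hd, t,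
      comp_leaf_left, comp_of_le, comp_of_lt_of_le, comp_of_lt, arity, Nat.reduceAdd, Nat.reduceSub]
  rw [key] at h1
  exact ⟨h1.1, _, h1.2⟩

/-- As for `β`, with instances of both `α` and `β` at weight 4. -/
theorem IsOperadIdeal.eta_mem [CharZero K] (hS : IsOperadIdeal d S) (hd : Even d)
    (hα : alpha K d ∈ S) : eta K ∈ S := by
  have h := hS.alpha_instance hd hα
  have hb := hS.beta_instance hd (hS.beta_mem hd hα)
  have h1 := hb leaf t leaf leaf leaf leaf leaf
  have h2 := hS.nodeMid hd leaf leaf (hS.nodeRight hd leaf leaf (h leaf leaf leaf leaf leaf))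
  have h3 := h leaf leaf leaf (node leaf leaf t) leaf
  have h4 := hb leaf leaf leaf t leaf leaf leaf
  have h5 := hb leaf leaf t leaf leaf leaf leaf
  have h6 := hS.nodeRight hd leaf leaf (h leaf leaf leaf leaf t)
  have h7 := hS.nodeRight hd leaf leaf (hS.nodeRight hd leaf leaf (h leaf leaf leaf leaf leaf))
  have h8 := hS.nodeMid hd leaf leaf (h leaf leaf leaf leaf t)
  have h9 := hS.nodeRight hd leaf leaf (h leaf leaf leaf t leaf)
  have h10 := hS.nodeRight hd leaf leaf (hS.nodeMid hd leaf leaf (h leaf leaf leaf leaf leaf))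
  have h11 := hb leaf leaf leaf leaf t leaf leaf
  have h12 := hb t leaf leaf leaf leaf leaf leaf
  have h13 := h leaf leaf leaf leaf (node leaf leaf t)
  have h14 := h leaf leaf leaf leaf (node leaf t leaf)
  have key :=
    S.add_mem (S.smul_mem (1/3 : K) h1.1) <|
    S.add_mem (S.smul_mem (-1/3 : K) h2.1) <|
    S.add_mem (S.smul_mem (2/3 : K) h3.1) <|
    S.add_mem (S.smul_mem (1/3 : K) h4.1) <|
    S.add_mem (S.smul_mem (1/3 : K) h5.1) <|
    S.add_mem (S.smul_mem (-1/3 : K) h6.1) <|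
    S.add_mem (S.smul_mem (-1/3 : K) h7.1) <|
    S.add_mem (S.smul_mem (-1/3 : K) h8.1) <|
    S.add_mem (S.smul_mem (-1/3 : K) h9.1) <|
    S.add_mem (S.smul_mem (-1/3 : K) h10.1) <|
    S.add_mem (S.smul_mem (1/3 : K) h11.1) <|
    S.add_mem (S.smul_mem (-2/3 : K) h12.1) <|
    S.add_mem (S.smul_mem (2/3 : K) h13.1) <|
    S.smul_mem (2/3 : K) h14.1
  convert key using 1
  simp only [eta, etaLead, t, map_add, nodeMid_mono, nodeRight_mono]
  module

/-- As for `η`. -/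
theorem IsOperadIdeal.theta_mem [CharZero K] (hS : IsOperadIdeal d S) (hd : Even d)
    (hα : alpha K d ∈ S) : theta K ∈ S := by
  have h := hS.alpha_instance hd hα
  have hb := hS.beta_instance hd (hS.beta_mem hd hα)
  have h1 := hb leaf leaf leaf t leaf leaf leaf
  have h2 := hS.nodeRight hd leaf leaf (hS.nodeRight hd leaf leaf (h leaf leaf leaf leaf leaf))
  have h3 := h leaf leaf leaf (node leaf leaf t) leaf
  have h4 := hS.nodeRight hd leaf leaf (hS.nodeMid hd leaf leaf (h leaf leaf leaf leaf leaf))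
  have h5 := hS.nodeMid hd leaf leaf (hS.nodeRight hd leaf leaf (h leaf leaf leaf leaf leaf))
  have h6 := hb leaf leaf leaf leaf t leaf leaf
  have h7 := hS.nodeRight hd leaf leaf (h leaf leaf leaf t leaf)
  have h8 := hS.nodeRight hd leaf leaf (h leaf leaf leaf leaf t)
  have h9 := hb leaf t leaf leaf leaf leaf leaf
  have h10 := h leaf leaf leaf leaf (node leaf leaf t)
  have h11 := hS.nodeMid hd leaf leaf (h leaf leaf leaf leaf t)
  have h12 := hb t leaf leaf leaf leaf leaf leaf
  have h13 := h leaf leaf leaf leaf (node leaf t leaf)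
  have h14 := hb leaf leaf t leaf leaf leaf leaf
  have key :=
    S.add_mem (S.smul_mem (2/3 : K) h1.1) <|
    S.add_mem (S.smul_mem (-2/3 : K) h2.1) <|
    S.add_mem (S.smul_mem (1/3 : K) h3.1) <|
    S.add_mem (S.smul_mem (-2/3 : K) h4.1) <|
    S.add_mem (S.smul_mem (-2/3 : K) h5.1) <|
    S.add_mem (S.smul_mem (2/3 : K) h6.1) <|
    S.add_mem (S.smul_mem (1/3 : K) h7.1) <|
    S.add_mem (S.smul_mem (1/3 : K) h8.1) <|
    S.add_mem (S.smul_mem (-1/3 : K) h9.1) <|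
    S.add_mem (S.smul_mem (1/3 : K) h10.1) <|
    S.add_mem (S.smul_mem (1/3 : K) h11.1) <|
    S.add_mem (S.smul_mem (-1/3 : K) h12.1) <|
    S.add_mem (S.smul_mem (1/3 : K) h13.1) <|
    S.smul_mem (-1/3 : K) h14.1
  convert key using 1
  simp only [theta, thetaLead, t, map_add, nodeMid_mono, nodeRight_mono]
  module

/-- As for `η`, using `η` itself as well. -/
theorem IsOperadIdeal.nu_mem [CharZero K] (hS : IsOperadIdeal d S) (hd : Even d)
    (hα : alpha K d ∈ S) : nu K ∈ S := by
  have h := hS.alpha_instance hd hα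
  have hb := hS.beta_instance hd (hS.beta_mem hd hα)
  have hη : HomogIn S (eta K) := ⟨hS.eta_mem hd hα, 9, eta_mem_homog⟩
  simp only [eta, etaLead] at hη
  have h1 := hb leaf leaf leaf leaf leaf t leaf
  have h2 := hb t leaf leaf leaf leaf leaf leaf
  have h3 := h leaf leaf leaf leaf (node leaf t leaf)
  have h4 := h leaf leaf leaf leaf (node leaf leaf t)
  have h5 := hη
  have h6 := h leaf leaf leaf (node leaf leaf t) leaf
  have key :=
    S.add_mem (S.smul_mem (-1 : K) h1.1) <|
    S.add_mem (S.smul_mem (-1 : K) h2.1) <|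
    S.add_mem (S.smul_mem (1 : K) h3.1) <|
    S.add_mem (S.smul_mem (1 : K) h4.1) <|
    S.add_mem (S.smul_mem (-1 : K) h5.1) <|
    S.smul_mem (1 : K) h6.1
  convert key using 1
  simp only [nu, nuLead, t]
  module

end Ideal

/-! ### The quotient algebra on normal trees -/

/-- Indices for the normal trees, i.e. those not divisible by any of the five leading monomials;
see `NormalIndex.tree`. The weights of `C k`, `D k`, `R k`, `S k j` are `k + 1`, `k + 2`, `k + 3`,
`k + j + 3`. -/
inductive NormalIndex : Type
  | e : NormalIndex
  | C (k : ℕ) : NormalIndex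
  | D (k : ℕ) : NormalIndex
  | R (k : ℕ) : NormalIndex
  | S (k j : ℕ) : NormalIndex

namespace NormalIndex

/-- A common name for `S`, `R` and `D 0`: the tree of `s k j` is `(∗ Cₖ (∗∗ Cⱼ))` where `Cₖ` is the
comb of weight `k`. Among the `s k j` only `s 0 0 = D 0` does not annihilate the algebra. -/
def s : ℕ → ℕ → NormalIndex
  | 0, 0 => D 0
  | k + 1, 0 => R k
  | k, j + 1 => S k j

end NormalIndex

open NormalIndex

section QuotientAlgebra

variable (K : Type*) [Field K]

/-- The basis vector of the algebra `NormalIndex →₀ K` with index `i`. -/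
def basisVec (i : NormalIndex) : NormalIndex →₀ K := Finsupp.single i 1

/-- The multiplication table: the normal form of the tree whose root has three normal trees
as children. A product vanishes if no argument is `e`, if some argument is `R` or `S`, and in the
remaining cases not listed. -/
def normalMul : NormalIndex → NormalIndex → NormalIndex → (NormalIndex →₀ K)
  | e, e, e => basisVec K (C 0)
  | e, e, C m => basisVec K (D m)
  | e, e, D m => basisVec K (s 0 (m + 1))
  | e, C k, e => basisVec K (C (k + 1))
  | e, C k, C m => (-1 : K) ^ m • basisVec K (s (k + 1) m)
  | e, C k, D m => basisVec K (s (k + 1) (m + 1))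
  | e, D k, e => -basisVec K (D (k + 1)) - (-1 : K) ^ k • basisVec K (s 0 (k + 1))
  | C k, e, e => -(-1 : K) ^ k • basisVec K (C (k + 1)) - basisVec K (D k)
      + (-1 : K) ^ k • basisVec K (s 0 k) - basisVec K (s k 0)
  | D k, e, e => -basisVec K (C (k + 2)) + (-1 : K) ^ k • basisVec K (D (k + 1))
      + basisVec K (s 0 (k + 1))
  | C k, e, C m => -(-1 : K) ^ (k + m) • basisVec K (s (k + 1) m) - basisVec K (s k (m + 1))
  | C k, e, D m => -(-1 : K) ^ k • basisVec K (s (k + 1) (m + 1))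
  | D k, e, C m => -(-1 : K) ^ m • basisVec K (s (k + 2) m)
  | D k, e, D m => -basisVec K (s (k + 2) (m + 1))
  | C k, C m, e => (-1 : K) ^ m • basisVec K (s k (m + 1))
  | C k, D m, e => basisVec K (s k (m + 2))
  | _, _, _ => 0

/-- The trilinear extension of the multiplication table. -/
def triple : (NormalIndex →₀ K) →ₗ[K] (NormalIndex →₀ K) →ₗ[K] (NormalIndex →₀ K) →ₗ[K]
    (NormalIndex →₀ K) :=
  Finsupp.linearCombination K fun i => Finsupp.linearCombination K fun j =>
    Finsupp.linearCombination K fun k => normalMul K i j k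

@[simp] theorem triple_basis (i j k : NormalIndex) :
    triple K (basisVec K i) (basisVec K j) (basisVec K k) = normalMul K i j k := by
  simp [triple, basisVec]

theorem normalMul_of_ne {i j k : NormalIndex} (hi : i ≠ e) (hj : j ≠ e) (hk : k ≠ e) :
    normalMul K i j k = 0 := by
  cases i <;> cases j <;> cases k <;> simp [normalMul] at *

/-- Elements all of whose products vanish. -/
def annihilator : Submodule K (NormalIndex →₀ K) where
  carrier := {w | ∀ u v, triple K w u v = 0 ∧ triple K u w v = 0 ∧ triple K u v w = 0}
  zero_mem' := by simp
  add_mem' := by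
    intro a b ha hb u v
    simp [ha u v, hb u v]
  smul_mem' := by
    intro c a ha u v
    simp [ha u v]

theorem mem_annihilator_of_basis {w : NormalIndex →₀ K}
    (h : ∀ i j, triple K w (basisVec K i) (basisVec K j) = 0 ∧
      triple K (basisVec K i) w (basisVec K j) = 0 ∧
      triple K (basisVec K i) (basisVec K j) w = 0) : w ∈ annihilator K := by
  intro u v
  induction u using Finsupp.induction_linear with
  | zero => simp
  | add u u' hu hu' => simp [hu, hu']
  | single i a =>
    induction v using Finsupp.induction_linear with
    | zero => simp
    | add v v' hv hv' => simp [hv, hv']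
    | single j b =>
      have hs (i : NormalIndex) (a : K) : Finsupp.single i a = a • basisVec K i := by
        simp [basisVec]
      simp only [hs i a, hs j b, map_smul, LinearMap.smul_apply, h i j, smul_zero, and_self]

theorem R_mem_annihilator (k : ℕ) : basisVec K (R k) ∈ annihilator K := by
  refine mem_annihilator_of_basis K fun i j => ?_
  cases i <;> cases j <;> simp [normalMul]

theorem S_mem_annihilator (k j : ℕ) : basisVec K (S k j) ∈ annihilator K := by
  refine mem_annihilator_of_basis K fun i j => ?_
  cases i <;> cases j <;> simp [normalMul]

theorem s_succ_mem_annihilator (k j : ℕ) : basisVec K (s k (j + 1)) ∈ annihilator K := by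
  cases k <;> exact S_mem_annihilator K _ _

theorem succ_s_mem_annihilator (k j : ℕ) : basisVec K (s (k + 1) j) ∈ annihilator K := by
  cases j
  · exact R_mem_annihilator K _
  · exact S_mem_annihilator K _ _

/-- A product with at most one argument `e` is a combination of `R`s and `S`s. -/
theorem normalMul_mem_annihilator {i j k : NormalIndex}
    (h : (i ≠ e ∧ j ≠ e) ∨ (i ≠ e ∧ k ≠ e) ∨ (j ≠ e ∧ k ≠ e)) :
    normalMul K i j k ∈ annihilator K := by
  have h1 := s_succ_mem_annihilator K
  have h2 := succ_s_mem_annihilator K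
  cases i <;> cases j <;> cases k <;> simp at h <;> simp only [normalMul, zero_mem] <;>
    repeat with_reducible first
      | exact h1 _ _
      | exact h2 _ _
      | apply Submodule.sub_mem
      | apply Submodule.neg_mem
      | apply Submodule.smul_mem

theorem triple_of_ne (w : NormalIndex →₀ K) (hw : w ∈ Submodule.span K (basisVec K '' {e}ᶜ))
    {i j : NormalIndex} (hi : i ≠ e) (hj : j ≠ e) :
    triple K w (basisVec K i) (basisVec K j) = 0 ∧
      triple K (basisVec K i) w (basisVec K j) = 0 ∧
      triple K (basisVec K i) (basisVec K j) w = 0 := by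
  induction hw using Submodule.span_induction with
  | mem x hx =>
    obtain ⟨k, hk, rfl⟩ := hx
    simp [normalMul_of_ne K hi hj hk, normalMul_of_ne K hk hi hj, normalMul_of_ne K hi hk hj]
  | zero => simp
  | add x y _ _ hx hy => simp [hx, hy]
  | smul c x _ hx => simp [hx]

/-- The generator `e` does not occur in products. -/
theorem normalMul_mem_span (i j k : NormalIndex) :
    normalMul K i j k ∈ Submodule.span K (basisVec K '' {e}ᶜ) := by
  have hb {i : NormalIndex} (hi : i ≠ e) : basisVec K i ∈ Submodule.span K (basisVec K '' {e}ᶜ) :=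
    Submodule.subset_span ⟨i, hi, rfl⟩
  have hs (k j : ℕ) : s k j ≠ e := by cases k <;> cases j <;> simp [s]
  have hC (k : ℕ) : C k ≠ e := by simp
  have hD (k : ℕ) : D k ≠ e := by simp
  cases i <;> cases j <;> cases k <;> simp only [normalMul, zero_mem] <;>
    repeat with_reducible first
      | exact hb (hs _ _)
      | exact hb (hC _)
      | exact hb (hD _)
      | apply Submodule.sub_mem
      | apply Submodule.add_mem
      | apply Submodule.neg_mem
      | apply Submodule.smul_mem

theorem triple_neg (a u v : NormalIndex →₀ K) : triple K (-a) u v = -triple K a u v := by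
  rw [← neg_one_smul K a, map_smul, LinearMap.smul_apply, LinearMap.smul_apply, neg_one_smul]

theorem triple_sub (a b u v : NormalIndex →₀ K) :
    triple K (a - b) u v = triple K a u v - triple K b u v := by
  rw [sub_eq_add_neg, map_add, LinearMap.add_apply, LinearMap.add_apply, triple_neg,
    sub_eq_add_neg]

/-- The left-hand side of partial associativity on basis vectors. -/
def assocSum (x y z u v : NormalIndex) : NormalIndex →₀ K :=
  triple K (normalMul K x y z) (basisVec K u) (basisVec K v) +
    triple K (basisVec K x) (normalMul K y z u) (basisVec K v) +
    triple K (basisVec K x) (basisVec K y) (normalMul K z u v)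

set_option maxHeartbeats 2000000 in
/-- Partial associativity when at least three of the five arguments are `e`. -/
theorem assocSum_two (x y : NormalIndex) :
    assocSum K x y e e e = 0 ∧ assocSum K x e y e e = 0 ∧ assocSum K x e e y e = 0 ∧
    assocSum K x e e e y = 0 ∧ assocSum K e x y e e = 0 ∧ assocSum K e x e y e = 0 ∧
    assocSum K e x e e y = 0 ∧ assocSum K e e x y e = 0 ∧ assocSum K e e x e y = 0 ∧
    assocSum K e e e x y = 0 := by
  have sign := neg_one_pow_eq_or K
  -- Zero indices are split off because `s k j` depends on whether `k` and `j` vanish.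
  rcases x with _ | (_ | k) | (_ | k) | k | ⟨k, j⟩ <;>
    rcases y with _ | (_ | m) | (_ | m) | m | ⟨m, l⟩
  all_goals
    refine ⟨?_, ?_, ?_, ?_, ?_, ?_, ?_, ?_, ?_, ?_⟩ <;>
    simp only [assocSum, normalMul, s, map_add, map_sub, map_neg, map_smul, triple_neg, triple_sub,
      triple_basis, LinearMap.add_apply, LinearMap.sub_apply, LinearMap.neg_apply,
      LinearMap.smul_apply, LinearMap.zero_apply, map_zero, smul_zero, neg_zero, sub_zero,
      add_zero, zero_add]
  all_goals
    try simp only [pow_succ, pow_add, pow_zero]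
    first
    | module
    | rcases sign k with h | h <;> simp only [h] <;> module
    | rcases sign m with h | h <;> simp only [h] <;> module

theorem assocSum_eq_zero (x y z u v : NormalIndex) : assocSum K x y z u v = 0 := by
  have out (i j k : NormalIndex) {i' j' : NormalIndex} (hi : i' ≠ e) (hj : j' ≠ e) :=
    triple_of_ne K _ (normalMul_mem_span K i j k) hi hj
  have ann {i j k : NormalIndex} (h : (i ≠ e ∧ j ≠ e) ∨ (i ≠ e ∧ k ≠ e) ∨ (j ≠ e ∧ k ≠ e)) :=
    normalMul_mem_annihilator K h
  have l {i j k : NormalIndex} (h) (u v) := (ann (i := i) (j := j) (k := k) h u v).1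
  have m {i j k : NormalIndex} (h) (u v) := (ann (i := i) (j := j) (k := k) h u v).2.1
  have r {i j k : NormalIndex} (h) (u v) := (ann (i := i) (j := j) (k := k) h u v).2.2
  by_cases hx : x = e <;> by_cases hy : y = e <;> by_cases hz : z = e <;> by_cases hu : u = e <;>
    by_cases hv : v = e
  -- With three arguments other than `e`, each of the three summands vanishes.
  all_goals first
    | simp [assocSum, normalMul_of_ne, *]; done
    | clear out l m r; subst_vars; simp only [assocSum_two]

theorem partial_assoc (x y z u v : NormalIndex →₀ K) :
    triple K (triple K x y z) u v + triple K x (triple K y z u) v +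
      triple K x y (triple K z u v) = 0 := by
  have hs (i : NormalIndex) (a : K) : Finsupp.single i a = a • basisVec K i := by
    simp [basisVec]
  induction x using Finsupp.induction_linear with
  | zero => simp
  | add x x' h h' =>
    simp only [map_add, LinearMap.add_apply]
    linear_combination (norm := module) h + h'
  | single x a =>
  induction y using Finsupp.induction_linear with
  | zero => simp
  | add y y' h h' =>
    simp only [map_add, LinearMap.add_apply]
    linear_combination (norm := module) h + h'
  | single y b =>
  induction z using Finsupp.induction_linear with
  | zero => simp
  | add z z' h h' =>
    simp only [map_add, LinearMap.add_apply]
    linear_combination (norm := module) h + h'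
  | single z c =>
  induction u using Finsupp.induction_linear with
  | zero => simp
  | add u u' h h' =>
    simp only [map_add, LinearMap.add_apply]
    linear_combination (norm := module) h + h'
  | single u f =>
  induction v using Finsupp.induction_linear with
  | zero => simp
  | add v v' h h' =>
    simp only [map_add]
    linear_combination (norm := module) h + h'
  | single v g =>
  have h := assocSum_eq_zero K x y z u v
  rw [assocSum] at h
  simp only [hs, map_smul, LinearMap.smul_apply, triple_basis]
  linear_combination (norm := module) (a * b * c * f * g) • h

end QuotientAlgebra

/-! ### Evaluation of trees in the quotient algebra -/

section Evaluation

variable {K : Type*} [Field K]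

/-- The value of a tree when leaf number `n` is assigned the element `x n` of the algebra.
Leaves are numbered from 1, so `x 0` plays no role. -/
def evalTree : (ℕ → NormalIndex →₀ K) → TTree → (NormalIndex →₀ K)
  | x, leaf => x 1
  | x, node a b c => triple K (evalTree x a) (evalTree (fun n => x (n + a.arity)) b)
      (evalTree (fun n => x (n + (a.arity + b.arity))) c)

theorem evalTree_congr {x y : ℕ → NormalIndex →₀ K} {p : TTree}
    (h : ∀ n, 1 ≤ n → n ≤ p.arity → x n = y n) : evalTree x p = evalTree y p := by
  induction p generalizing x y with
  | leaf => exact h 1 le_rfl le_rfl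
  | node a b c iha ihb ihc =>
    simp only [arity] at h
    rw [evalTree, evalTree, iha fun n h1 h2 => h n h1 (by omega),
      ihb fun n h1 h2 => h _ (by omega) (by omega), ihc fun n h1 h2 => h _ (by omega) (by omega)]

/-- The assignment of values to the leaves of `p` for which `p` has the same value as `p ∘ᵢ q`
under `x`. -/
def graftValue (x : ℕ → NormalIndex →₀ K) (i : ℕ) (q : TTree) (n : ℕ) : NormalIndex →₀ K :=
  if n < i then x n else if n = i then evalTree (fun m => x (m + (i - 1))) q
  else x (n + q.arity - 1)

theorem evalTree_comp (x : ℕ → NormalIndex →₀ K) (p q : TTree) (i : ℕ) (h1 : 1 ≤ i)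
    (h2 : i ≤ p.arity) : evalTree x (p.comp i q) = evalTree (graftValue x i q) p := by
  have hq := q.arity_pos
  induction p generalizing x i with
  | leaf =>
    obtain rfl : i = 1 := by simp only [arity] at h2; omega
    simp [evalTree, comp, graftValue]
  | node a b c iha ihb ihc =>
    simp only [arity] at h2
    by_cases ha : i ≤ a.arity
    · have := arity_comp a q i h1 ha
      rw [comp_of_le ha, evalTree, evalTree, iha _ _ h1 ha]
      congr 1
      · congr 1
        refine evalTree_congr fun n hn _ => ?_
        simp only [graftValue]
        rw [if_neg (by omega), if_neg (by omega)]
        congr 1; omega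
      · refine evalTree_congr fun n hn _ => ?_
        simp only [graftValue]
        rw [if_neg (by omega), if_neg (by omega)]
        congr 1; omega
    · have hxa : evalTree (graftValue x i q) a = evalTree x a := by
        refine evalTree_congr fun n hn _ => ?_
        rw [graftValue, if_pos (by omega)]
      have shift (m n : ℕ) (hm : m < i) :
          graftValue (fun n => x (n + m)) (i - m) q n = graftValue x i q (n + m) := by
        simp only [graftValue]
        have e₁ : n < i - m ↔ n + m < i := by omega
        have e₂ : n = i - m ↔ n + m = i := by omega
        simp only [e₁, e₂]
        split_ifs
        · rfl
        · congr 1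
          funext k
          congr 1; omega
        · congr 1; omega
      by_cases hb : i ≤ a.arity + b.arity
      · have := arity_comp b q (i - a.arity) (by omega) (by omega)
        rw [comp_of_lt_of_le (by omega) hb, evalTree, evalTree, hxa,
          ihb _ _ (by omega) (by omega)]
        congr 1
        · congr 1
          exact evalTree_congr fun n _ _ => shift _ n (by omega)
        · refine evalTree_congr fun n hn _ => ?_
          simp only [graftValue]
          rw [if_neg (by omega), if_neg (by omega)]
          congr 1; omega
      · rw [comp_of_lt (by omega), evalTree, evalTree, hxa, ihc _ _ (by omega) (by omega)]
        congr 1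
        · congr 1
          refine evalTree_congr fun n hn _ => ?_
          rw [graftValue, if_pos (by omega)]
        · exact evalTree_congr fun n _ _ => shift _ n (by omega)

/-- Linear extension of `evalTree`. -/
def evalPoly (x : ℕ → NormalIndex →₀ K) : LT K →ₗ[K] (NormalIndex →₀ K) :=
  Finsupp.linearCombination K (evalTree x)

theorem evalPoly_single (x : ℕ → NormalIndex →₀ K) (p : TTree) (a : K) :
    evalPoly x (Finsupp.single p a) = a • evalTree x p := by
  simp [evalPoly]

theorem evalPoly_apply (x : ℕ → NormalIndex →₀ K) (f : LT K) :
    evalPoly x f = ∑ p ∈ f.support, f p • evalTree x p := rfl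

theorem evalPoly_pcomp {d : ℤ} (hd : Even d) (x : ℕ → NormalIndex →₀ K) (f g : LT K) (i : ℕ) :
    evalPoly x (pcomp d f i g) =
      ∑ p ∈ f.support, ∑ q ∈ g.support, (f p * g q) • evalTree x (p.comp i q) := by
  simp only [pcomp, Finsupp.sum, map_sum, evalPoly_single, koszulSign_of_even hd, one_mul]

/-- Identities of the algebra may be grafted onto a leaf of a tree: the value of the tree is linear
in the value of the grafted part, and by homogeneity the numbering of the leaves to the right does
not depend on the grafted tree. -/
theorem sum_evalTree_comp_eq_zero {f : LT K} {n : ℕ} (hf : f ∈ homog K n)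
    (h : ∀ x, evalPoly x f = 0) (p : TTree) (j : ℕ) (h1 : 1 ≤ j) (h2 : j ≤ p.arity)
    (x : ℕ → NormalIndex →₀ K) : ∑ q ∈ f.support, f q • evalTree x (p.comp j q) = 0 := by
  have hn {q} (hq : q ∈ f.support) := arity_eq_of_mem_homog hf (Finsupp.mem_support_iff.1 hq)
  induction p generalizing x j with
  | leaf => exact h x
  | node a b c iha ihb ihc =>
    simp only [arity] at h2
    by_cases ha : j ≤ a.arity
    · rw [← LinearMap.zero_apply (σ₁₂ := RingHom.id K)
        (evalTree (fun k => x (k + (a.arity + n - 1 + b.arity))) c),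
        ← LinearMap.zero_apply (σ₁₂ := RingHom.id K)
        (evalTree (fun k => x (k + (a.arity + n - 1))) b), ← map_zero (triple K),
        ← iha j h1 ha x]
      simp only [map_sum, map_smul, LinearMap.sum_apply, LinearMap.smul_apply]
      refine Finset.sum_congr rfl fun q hq => ?_
      have := arity_comp a q j h1 ha
      have e : (a.comp j q).arity = a.arity + n - 1 := by rw [← hn hq]; omega
      rw [comp_of_le ha, evalTree, e]
    by_cases hb : j ≤ a.arity + b.arity
    · rw [← LinearMap.zero_apply (σ₁₂ := RingHom.id K)
        (evalTree (fun k => x (k + (a.arity + (b.arity + n - 1)))) c),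
        ← map_zero (triple K (evalTree x a)),
        ← ihb (j - a.arity) (by omega) (by omega) (fun k => x (k + a.arity))]
      simp only [map_sum, map_smul, LinearMap.sum_apply, LinearMap.smul_apply]
      refine Finset.sum_congr rfl fun q hq => ?_
      have := arity_comp b q (j - a.arity) (by omega) (by omega)
      have e : (b.comp (j - a.arity) q).arity = b.arity + n - 1 := by rw [← hn hq]; omega
      rw [comp_of_lt_of_le (by omega) hb, evalTree, e]
    · rw [← map_zero (triple K (evalTree x a) (evalTree (fun k => x (k + a.arity)) b)),
        ← ihc (j - (a.arity + b.arity)) (by omega) (by omega)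
          (fun k => x (k + (a.arity + b.arity)))]
      simp only [map_sum, map_smul]
      refine Finset.sum_congr rfl fun q hq => ?_
      rw [comp_of_lt (by omega), evalTree]

theorem filter_arity_of_mem_homog {f : LT K} {m : ℕ} (hf : f ∈ homog K m) (n : ℕ) :
    f.filter (fun p => p.arity = n) = if n = m then f else 0 := by
  split_ifs with h
  · rw [Finsupp.filter_eq_self_iff]
    exact fun p hp => (arity_eq_of_mem_homog hf hp).trans h.symm
  · rw [Finsupp.filter_eq_zero_iff]
    intro p hp
    by_contra h0
    exact h (hp.symm.trans (arity_eq_of_mem_homog hf h0))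

variable (K) in
/-- The tree polynomials all of whose homogeneous components are identities of the algebra. -/
def identities : Submodule K (LT K) where
  carrier := {f | ∀ n x, evalPoly x (f.filter fun p => p.arity = n) = 0}
  zero_mem' := by
    intro n x
    rw [Finsupp.filter_zero, map_zero]
  add_mem' := by
    intro f g hf hg n x
    rw [Finsupp.filter_add, map_add, hf, hg, add_zero]
  smul_mem' := by
    intro c f hf n x
    rw [Finsupp.filter_smul, map_smul, hf, smul_zero]

theorem mem_identities_iff {f : LT K} {m : ℕ} (hf : f ∈ homog K m) :
    f ∈ identities K ↔ ∀ x, evalPoly x f = 0 := by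
  constructor
  · intro h x
    have := h m x
    rwa [filter_arity_of_mem_homog hf, if_pos rfl] at this
  · intro h n x
    rw [filter_arity_of_mem_homog hf]
    split_ifs
    · exact h x
    · exact map_zero _

theorem filter_arity_mem_homog (f : LT K) (n : ℕ) :
    f.filter (fun p => p.arity = n) ∈ homog K n := by
  rw [homog, Finsupp.mem_supported]
  intro p hp
  simp only [Finsupp.support_filter, Finset.coe_filter] at hp
  exact hp.2

theorem isOperadIdeal_identities {d : ℤ} (hd : Even d) : IsOperadIdeal d (identities K) where
  homogeneous f hf n :=
    (mem_identities_iff (filter_arity_mem_homog f n)).2 fun x => hf n x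
  pcomp_right_mem m n i f g hf hm hn h1 h2 := by
    rw [mem_identities_iff (pcomp_mem_homog hm hn h1 h2)]
    rw [mem_identities_iff hm] at hf
    intro x
    rw [evalPoly_pcomp hd, Finset.sum_comm]
    refine Finset.sum_eq_zero fun q _ => ?_
    rw [← smul_zero (g q), ← hf (graftValue x i q), evalPoly_apply, Finset.smul_sum]
    refine Finset.sum_congr rfl fun p hp => ?_
    have := arity_eq_of_mem_homog hm (Finsupp.mem_support_iff.1 hp)
    rw [evalTree_comp x p q i h1 (by omega), smul_smul, mul_comm]
  pcomp_left_mem m n j f g hf hm hn h1 h2 := by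
    rw [mem_identities_iff (pcomp_mem_homog hn hm h1 h2)]
    rw [mem_identities_iff hm] at hf
    intro x
    rw [evalPoly_pcomp hd]
    refine Finset.sum_eq_zero fun p hp => ?_
    have := arity_eq_of_mem_homog hn (Finsupp.mem_support_iff.1 hp)
    have h := sum_evalTree_comp_eq_zero hm hf p j h1 (by omega) x
    simp only [← smul_smul]
    rw [← Finset.smul_sum, h, smul_zero]

theorem alpha_mem_identities {d : ℤ} (hd : Even d) : alpha K d ∈ identities K := by
  rw [mem_identities_iff (alpha_mem_homog hd)]
  intro x
  rw [alpha_eq hd]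
  simp only [mono, map_add, evalPoly_single, one_smul]
  exact partial_assoc K (x 1) (x 2) (x 3) (x 4) (x 5)

theorem idealSpan_alpha_le_identities {d : ℤ} (hd : Even d) :
    idealSpan d {alpha K d} ≤ identities K :=
  sInf_le ⟨isOperadIdeal_identities hd, Set.singleton_subset_iff.2 (alpha_mem_identities hd)⟩

end Evaluation

/-! ### Normal trees -/

/-- The comb of weight `k`, nested in the middle child. -/
def TTree.comb : ℕ → TTree
  | 0 => leaf
  | k + 1 => node leaf (comb k) leaf

@[simp] theorem TTree.arity_comb (k : ℕ) : (comb k).arity = 2 * k + 1 := by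
  induction k with
  | zero => rfl
  | succ k ih => simp only [comb, arity, ih]; omega

/-- The normal tree with a given index. -/
def NormalIndex.tree : NormalIndex → TTree
  | e => leaf
  | C k => comb (k + 1)
  | D k => node leaf leaf (comb (k + 1))
  | R k => node leaf (comb (k + 1)) (node leaf leaf leaf)
  | S k j => node leaf (comb k) (node leaf leaf (comb (j + 1)))

theorem tree_s (k j : ℕ) : (s k j).tree = node leaf (comb k) (node leaf leaf (comb j)) := by
  cases k <;> cases j <;> rfl

/-- A tree with none of the five leading monomials as a divisor is one of the normal trees. -/
theorem exists_tree_eq (q : TTree) (hα : alphaLead.Occurs q = false)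
    (hβ : betaLead.Occurs q = false) (hη : etaLead.Occurs q = false)
    (hθ : thetaLead.Occurs q = false) (hν : nuLead.Occurs q = false) : ∃ i, tree i = q := by
  induction q with
  | leaf => exact ⟨e, rfl⟩
  | node a b c _ ihb ihc =>
    simp only [Occurs, Bool.or_eq_false_iff] at hα hβ hη hθ hν
    obtain ⟨i, rfl⟩ := ihb hα.1.2 hβ.1.2 hη.1.2 hθ.1.2 hν.1.2
    obtain ⟨j, rfl⟩ := ihc hα.2 hβ.2 hη.2 hθ.2 hν.2
    replace hα := hα.1.1.1
    replace hβ := hβ.1.1.1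
    replace hη := hη.1.1.1
    replace hθ := hθ.1.1.1
    replace hν := hν.1.1.1
    cases a with
    | node => simp [alphaLead, t, Fits] at hα
    | leaf =>
    have hi : ∃ k, tree i = comb k := by
      cases i with
      | e => exact ⟨0, rfl⟩
      | C k => exact ⟨k + 1, rfl⟩
      | _ => simp [betaLead, t, Fits, tree, comb] at hβ
    obtain ⟨k, hk⟩ := hi
    rw [hk] at hη hθ hν ⊢
    rcases j with _ | m | m | m | ⟨_ | l, m⟩
    · exact ⟨C k, rfl⟩
    · rcases k with _ | k
      · exact ⟨D m, rfl⟩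
      · rcases m with _ | m
        · exact ⟨R k, rfl⟩
        · simp [etaLead, t, Fits, tree, comb] at hη
    · exact ⟨S k m, rfl⟩
    · simp [thetaLead, t, Fits, tree, comb] at hθ
    · simp [nuLead, t, Fits, tree, comb] at hν
    · simp [thetaLead, t, Fits, tree, comb] at hθ

section NormalForm

variable (K : Type*) [Field K]

/-- The normal form of a tree, as an element of the algebra. -/
def normalForm : TTree → (NormalIndex →₀ K) := evalTree fun _ => basisVec K e

theorem normalForm_node (a b c : TTree) :
    normalForm K (node a b c) = triple K (normalForm K a) (normalForm K b) (normalForm K c) := rfl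

theorem normalForm_leaf : normalForm K leaf = basisVec K e := rfl

theorem normalForm_comb (k : ℕ) : normalForm K (comb (k + 1)) = basisVec K (C k) := by
  induction k with
  | zero => simp [comb, normalForm_node, normalForm_leaf, normalMul]
  | succ k ih => rw [comb, normalForm_node, ih]; simp [normalForm_leaf, normalMul]

theorem normalForm_tree (i : NormalIndex) : normalForm K (tree i) = basisVec K i := by
  cases i with
  | e => rfl
  | C k => exact normalForm_comb K k
  | D k => simp [tree, normalForm_node, normalForm_comb, normalForm_leaf, normalMul]
  | R k => simp [tree, normalForm_node, normalForm_comb, normalForm_leaf, normalMul, s]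
  | S k j =>
    have h0 : comb 0 = leaf := rfl
    cases k <;> simp [tree, normalForm_node, normalForm_comb, normalForm_leaf, normalMul, s, h0]

theorem basisVec_mem_supported {P : Set NormalIndex} {i : NormalIndex} (h : i ∈ P) :
    basisVec K i ∈ Finsupp.supported K K P := Finsupp.single_mem_supported K 1 h

/-- The multiplication table never increases trees in path-lex order. -/
theorem normalMul_mem_supported (i j k : NormalIndex) :
    normalMul K i j k ∈
      Finsupp.supported K K {l | WeakLE (tree l) (node (tree i) (tree j) (tree k))} := by
  have hs (k j : ℕ) (q : TTree)
      (h : WeakLE (node leaf (comb k) (node leaf leaf (comb j))) q) : WeakLE (tree (s k j)) q := by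
    rwa [tree_s]
  have hm (m : ℕ) : WeakLE (node leaf leaf (comb m)) (comb (m + 1)) := by
    rcases m with _ | m
    · exact .refl _
    · exact weakLE_of_leaf_leaf_node (by simp only [arity, arity_comb, comb]; omega)
  cases i <;> cases j <;> cases k <;> simp only [normalMul, zero_mem] <;>
    repeat' with_reducible first
      | apply basisVec_mem_supported
      | apply Submodule.sub_mem
      | apply Submodule.add_mem
      | apply Submodule.neg_mem
      | apply Submodule.smul_mem
  all_goals rw [Set.mem_ofPred_eq]
  all_goals try apply hs
  all_goals first
    | exact .refl _
    | exact .node (.refl _) (.refl _) (hm _)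
    | exact weakLE_of_leaf_node (by simp only [arity, arity_comb, comb, tree] <;> omega)
    | exact weakLE_of_leaf_leaf_node (by simp only [arity, arity_comb, comb, tree]; omega)

theorem triple_mem_supported {P Q R T : Set NormalIndex} {x y z : NormalIndex →₀ K}
    (hx : x ∈ Finsupp.supported K K P) (hy : y ∈ Finsupp.supported K K Q)
    (hz : z ∈ Finsupp.supported K K R)
    (h : ∀ i ∈ P, ∀ j ∈ Q, ∀ k ∈ R, normalMul K i j k ∈ Finsupp.supported K K T) :
    triple K x y z ∈ Finsupp.supported K K T := by
  simp only [triple, Finsupp.linearCombination_apply, Finsupp.sum, LinearMap.sum_apply,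
    LinearMap.smul_apply]
  exact Submodule.sum_mem _ fun i hi => Submodule.smul_mem _ _ <| Submodule.sum_mem _ fun j hj =>
    Submodule.smul_mem _ _ <| Submodule.sum_mem _ fun k hk => Submodule.smul_mem _ _ <|
      h i (hx hi) j (hy hj) k (hz hk)

/-- Only trees at most `p` occur in the normal form of `p`. -/
theorem normalForm_mem_supported (p : TTree) :
    normalForm K p ∈ Finsupp.supported K K {l | WeakLE (tree l) p} := by
  induction p with
  | leaf => exact basisVec_mem_supported K (WeakLE.refl leaf)
  | node a b c iha ihb ihc =>
    rw [normalForm_node]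
    refine triple_mem_supported K iha ihb ihc fun i hi j hj k hk => ?_
    exact Finsupp.supported_mono (fun l hl => WeakLE.trans hl (.node hi hj hk))
      (normalMul_mem_supported K i j k)

end NormalForm

/-! ### Leading monomials -/

section Leading

variable {K : Type*} [Field K]

theorem IsLeadingMonomial.unique {f : LT K} {p q : TTree} (hp : IsLeadingMonomial f p)
    (hq : IsLeadingMonomial f q) : p = q := by
  by_contra h
  exact (hp.2 q hq.1 (Ne.symm h)).asymm (hq.2 p hp.1 h)

theorem exists_isLeadingMonomial {f : LT K} (hf : f ≠ 0) : ∃ p, IsLeadingMonomial f p := by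
  obtain ⟨p, hp, hmax⟩ := Finset.exists_max_image f.support path (Finsupp.support_nonempty_iff.2 hf)
  exact ⟨p, hp, fun q hq hne => (hmax q hq).lt_of_ne fun h => hne (path_injective h)⟩

theorem mem_support_add {f g : LT K} {s r : List TTree} (hf : ∀ q ∈ f.support, q ∈ s)
    (hg : ∀ q ∈ g.support, q ∈ r) : ∀ q ∈ (f + g).support, q ∈ s ++ r := by
  classical
  intro q hq
  rw [List.mem_append]
  exact (Finset.mem_union.1 (Finsupp.support_add hq)).imp (hf q) (hg q)

theorem mem_support_mono (p : TTree) : ∀ q ∈ (mono K p).support, q ∈ [p] := by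
  intro q hq
  rw [List.mem_singleton]
  exact Finset.mem_singleton.1 (Finsupp.support_single_subset hq)

theorem mem_support_alpha {d : ℤ} (hd : Even d) : ∀ q ∈ (alpha K d).support,
    q ∈ [alphaLead, node leaf t leaf, node leaf leaf t] := by
  rw [alpha_eq hd]
  exact mem_support_add (mem_support_add (mem_support_mono _) (mem_support_mono _))
    (mem_support_mono _)

theorem mem_support_beta : ∀ q ∈ (beta K).support,
    q ∈ [betaLead, node leaf leaf (node leaf t leaf), node leaf leaf (node leaf leaf t)] :=
  mem_support_add (mem_support_add (mem_support_mono _) (mem_support_mono _)) (mem_support_mono _)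

theorem mem_support_eta : ∀ q ∈ (eta K).support, q ∈ [etaLead, node leaf t (node leaf leaf t)] :=
  mem_support_add (mem_support_mono _) (mem_support_mono _)

theorem alpha_alphaLead {d : ℤ} (hd : Even d) : alpha K d alphaLead = 1 := by
  simp [alpha_eq hd, mono, alphaLead, t]

theorem beta_betaLead : beta K betaLead = 1 := by
  simp [beta, mono, betaLead, t]

theorem eta_etaLead : eta K etaLead = 1 := by
  simp [eta, mono, etaLead, t]

theorem theta_thetaLead : theta K thetaLead = 1 := by
  simp [theta, mono]

theorem nu_nuLead : nu K nuLead = 1 := by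
  simp [nu, mono]

theorem isLeadingMonomial_of_list {f : LT K} {p : TTree} {s : List TTree} (hp : f p = 1)
    (hs : ∀ q ∈ f.support, q ∈ p :: s) (hlt : ∀ q ∈ s, q.path < p.path) : IsLeadingMonomial f p :=
  ⟨Finsupp.mem_support_iff.2 (hp ▸ one_ne_zero), fun q hq hne =>
    hlt q ((List.mem_cons.1 (hs q hq)).resolve_left hne)⟩

theorem isLeadingMonomial_alpha {d : ℤ} (hd : Even d) :
    IsLeadingMonomial (alpha K d) alphaLead :=
  isLeadingMonomial_of_list (alpha_alphaLead hd) (mem_support_alpha hd) (by decide)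

theorem isLeadingMonomial_beta : IsLeadingMonomial (beta K) betaLead :=
  isLeadingMonomial_of_list beta_betaLead mem_support_beta (by decide)

theorem isLeadingMonomial_eta : IsLeadingMonomial (eta K) etaLead :=
  isLeadingMonomial_of_list eta_etaLead mem_support_eta (by decide)

theorem isLeadingMonomial_theta : IsLeadingMonomial (theta K) thetaLead :=
  isLeadingMonomial_of_list theta_thetaLead (mem_support_mono _) (by decide)

theorem isLeadingMonomial_nu : IsLeadingMonomial (nu K) nuLead :=
  isLeadingMonomial_of_list nu_nuLead (mem_support_mono _) (by decide)

end Leading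

/-! ### Reduced Gröbner bases -/

section Groebner

variable {K : Type*} [Field K] {d : ℤ}

theorem subset_idealSpan (G : Set (LT K)) : G ⊆ idealSpan d G := by
  intro g hg
  simp only [idealSpan, SetLike.mem_coe, Submodule.mem_sInf]
  exact fun S hS => hS.2 hg

theorem IsGroebnerBasis.subset {G : Set (LT K)} {I : Submodule K (LT K)}
    (h : IsGroebnerBasis d G I) : G ⊆ I :=
  h.span_eq ▸ subset_idealSpan G

/-- In two reduced Gröbner bases of the same ideal, an element of the first one has the same leading
monomial as some element of the second one. -/
theorem IsReducedGroebnerBasis.exists_same_lead {G H : Set (LT K)} {I : Submodule K (LT K)}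
    (hG : IsReducedGroebnerBasis d G I) (hH : IsReducedGroebnerBasis d H I) {g : LT K}
    (hg : g ∈ G) : ∃ h ∈ H, ∃ p, IsLeadingMonomial g p ∧ IsLeadingMonomial h p := by
  obtain ⟨p, hp, h, hh, q, hq, hqp⟩ :=
    hH.groebner.divides g (hG.groebner.subset hg) (hG.groebner.relation g hg)
  obtain ⟨q', hq', g', hg', p', hp', hpq⟩ :=
    hG.groebner.divides h (hH.groebner.subset hh) (hH.groebner.relation h hh)
  obtain rfl := hq.unique hq'
  have hgg : g' = g := by
    by_contra hne
    exact hG.reduced g hg g' hg' hne p' hp' p hp.1 (hpq.trans hqp)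
  subst hgg
  obtain rfl := hp.unique hp'
  obtain rfl := hqp.antisymm hpq
  exact ⟨h, hh, q, hp, hq⟩

theorem IsRelation.mem_homog_arity {f : LT K} (hf : IsRelation f) {p : TTree} (hp : f p ≠ 0) :
    f ∈ homog K p.arity := by
  obtain ⟨_, n, hn⟩ := hf
  rwa [arity_eq_of_mem_homog hn hp]

/-- A tree of an element `g` of a reduced Gröbner basis that is divisible by the leading monomial of
some element of the basis is the leading monomial of `g`. -/
theorem IsReducedGroebnerBasis.eq_lead {G : Set (LT K)} {I : Submodule K (LT K)}
    (hG : IsReducedGroebnerBasis d G I) {g f : LT K} (hg : g ∈ G) {p q : TTree}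
    (hp : IsLeadingMonomial g p) (hq : q ∈ g.support) (hf : f ∈ I) (hr : IsRelation f)
    (hfq : IsLeadingMonomial f q) : q = p := by
  obtain ⟨q', hq', g', hg', p', hp', hdiv⟩ := hG.groebner.divides f hf hr
  obtain rfl := hfq.unique hq'
  have hgg : g' = g := by
    by_contra hne
    exact hG.reduced g hg g' hg' hne p' hp' q hq hdiv
  subst hgg
  obtain rfl := hp.unique hp'
  have hm := (hG.groebner.relation g' hg).mem_homog_arity (Finsupp.mem_support_iff.1 hp.1)
  exact (hdiv.eq_of_arity_le (arity_eq_of_mem_homog hm (Finsupp.mem_support_iff.1 hq)).le).symm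

theorem IsReducedGroebnerBasis.subset_of {G H : Set (LT K)} {I : Submodule K (LT K)}
    (hG : IsReducedGroebnerBasis d G I) (hH : IsReducedGroebnerBasis d H I) : G ⊆ H := by
  intro g hg
  obtain ⟨h, hh, p, hgp, hhp⟩ := hG.exists_same_lead hH hg
  suffices g = h by rwa [this]
  by_contra hne
  have hne' : g - h ≠ 0 := sub_ne_zero.2 hne
  have hgp0 := Finsupp.mem_support_iff.1 hgp.1
  have hhp0 := Finsupp.mem_support_iff.1 hhp.1
  have hrel : IsRelation (g - h) := ⟨hne', p.arity, Submodule.sub_mem _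
    ((hG.groebner.relation g hg).mem_homog_arity hgp0)
    ((hH.groebner.relation h hh).mem_homog_arity hhp0)⟩
  have hmem : g - h ∈ I := I.sub_mem (hG.groebner.subset hg) (hH.groebner.subset hh)
  obtain ⟨q, hq⟩ := exists_isLeadingMonomial hne'
  have hq0 : g q - h q ≠ 0 := Finsupp.mem_support_iff.1 hq.1
  -- The leading terms cancel, while every other tree of `g` and of `h` is reduced.
  have hqp : q ≠ p := by
    rintro rfl
    rw [hG.monic g hg q hgp, hH.monic h hh q hhp, sub_self] at hq0
    exact hq0 rfl
  have hgq : g q = 0 := by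
    by_contra h0
    exact hqp (hG.eq_lead hg hgp (Finsupp.mem_support_iff.2 h0) hmem hrel hq)
  have hhq : h q = 0 := by
    by_contra h0
    exact hqp (hH.eq_lead hh hhp (Finsupp.mem_support_iff.2 h0) hmem hrel hq)
  rw [hgq, hhq, sub_self] at hq0
  exact hq0 rfl

end Groebner

/-! ### The reduced Gröbner basis of partial associativity -/

section Main

variable {K : Type*} [Field K] {d : ℤ}

theorem evalPoly_normalForm_apply (f : LT K) (i : NormalIndex) :
    evalPoly (fun _ => basisVec K e) f i = ∑ q ∈ f.support, f q * normalForm K q i := by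
  rw [evalPoly_apply, Finsupp.finsetSum_apply]
  rfl

/-- No nonzero homogeneous element of the ideal has a normal leading monomial: its normal form would
have a nonzero coefficient at that monomial, but elements of the ideal have normal form zero. -/
theorem leadingMonomial_ne_tree (hd : Even d) {f : LT K} (hf : f ∈ idealSpan d {alpha K d})
    (hr : IsRelation f) {p : TTree} (hp : IsLeadingMonomial f p) (i : NormalIndex) :
    tree i ≠ p := by
  rintro rfl
  obtain ⟨_, n, hn⟩ := hr
  have h0 := (mem_identities_iff hn).1 (idealSpan_alpha_le_identities hd hf) fun _ => basisVec K e
  have h1 := evalPoly_normalForm_apply f i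
  rw [h0, Finset.sum_eq_single (tree i), normalForm_tree, basisVec, Finsupp.single_eq_same,
    mul_one] at h1
  · exact Finsupp.mem_support_iff.1 hp.1 h1.symm
  · intro q hq hne
    by_contra hne0
    have hle : WeakLE (tree i) q := (Finsupp.mem_supported K _).1 (normalForm_mem_supported K q)
      (Finsupp.mem_support_iff.2 (right_ne_zero_of_mul hne0))
    exact not_lt_of_ge hle.2 (precedes_iff.1 (hp.2 q hq hne))
  · exact fun h => absurd hp.1 h

variable (K d) in
/-- The five elements of the Gröbner basis, each with its leading monomial and a list of the trees
that occur in it. -/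
inductive BasisElement : LT K → TTree → List TTree → Prop
  | alpha : BasisElement (alpha K d) alphaLead [alphaLead, node leaf t leaf, node leaf leaf t]
  | beta : BasisElement (beta K) betaLead
      [betaLead, node leaf leaf (node leaf t leaf), node leaf leaf (node leaf leaf t)]
  | eta : BasisElement (eta K) etaLead [etaLead, node leaf t (node leaf leaf t)]
  | theta : BasisElement (theta K) thetaLead [thetaLead]
  | nu : BasisElement (nu K) nuLead [nuLead]

variable (K d) in
/-- The set `{α, β, η, θ, ν}`. -/
abbrev fiveRelations : Set (LT K) := {alpha K d, beta K, eta K, theta K, nu K}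

theorem exists_basisElement {g : LT K} (hg : g ∈ fiveRelations K d) :
    ∃ p s, BasisElement K d g p s := by
  rcases hg with rfl | rfl | rfl | rfl | rfl
  exacts [⟨_, _, .alpha⟩, ⟨_, _, .beta⟩, ⟨_, _, .eta⟩, ⟨_, _, .theta⟩, ⟨_, _, .nu⟩]

namespace BasisElement

variable {g h : LT K} {p q : TTree} {s r : List TTree}

theorem isLeadingMonomial (hd : Even d) (hg : BasisElement K d g p s) :
    IsLeadingMonomial g p := by
  cases hg
  exacts [isLeadingMonomial_alpha hd, isLeadingMonomial_beta, isLeadingMonomial_eta,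
    isLeadingMonomial_theta, isLeadingMonomial_nu]

theorem monic (hd : Even d) (hg : BasisElement K d g p s) : g p = 1 := by
  cases hg
  exacts [alpha_alphaLead hd, beta_betaLead, eta_etaLead, theta_thetaLead, nu_nuLead]

theorem mem_list (hd : Even d) (hg : BasisElement K d g p s) : ∀ q ∈ g.support, q ∈ s := by
  cases hg
  exacts [mem_support_alpha hd, mem_support_beta, mem_support_eta, mem_support_mono _,
    mem_support_mono _]

theorem isRelation (hd : Even d) (hg : BasisElement K d g p s) : IsRelation g := by
  refine ⟨fun h0 => ?_, ?_⟩
  · have := hg.monic hd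
    rw [h0, Finsupp.zero_apply] at this
    exact zero_ne_one this
  · cases hg
    exacts [⟨_, alpha_mem_homog hd⟩, ⟨_, beta_mem_homog⟩, ⟨_, eta_mem_homog⟩, ⟨_, theta_mem_homog⟩,
      ⟨_, nu_mem_homog⟩]

theorem mem_ideal [CharZero K] (hd : Even d) (hg : BasisElement K d g p s)
    {S : Submodule K (LT K)} (hS : IsOperadIdeal d S) (hα : TernaryOperad.alpha K d ∈ S) :
    g ∈ S := by
  cases hg
  exacts [hα, hS.beta_mem hd hα, hS.eta_mem hd hα, hS.theta_mem hd hα, hS.nu_mem hd hα]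

theorem not_divides (hg : BasisElement K d g p s) (hh : BasisElement K d h q r) (hne : h ≠ g) :
    ∀ u ∈ s, ¬ Divides q u := by
  simp only [divides_iff_occurs]
  cases hg <;> cases hh <;> first | exact absurd rfl hne | decide

end BasisElement

theorem idealSpan_fiveRelations [CharZero K] (hd : Even d) :
    idealSpan d (fiveRelations K d) = idealSpan d {alpha K d} := by
  refine le_antisymm (le_sInf fun S hS => sInf_le ⟨hS.1, fun g hg => ?_⟩)
    (sInf_le_sInf fun S hS => ⟨hS.1, Set.singleton_subset_iff.2 (hS.2 (Or.inl rfl))⟩)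
  obtain ⟨p, s, hgp⟩ := exists_basisElement hg
  exact hgp.mem_ideal hd hS.1 (hS.2 rfl)

theorem isGroebnerBasis_fiveRelations [CharZero K] (hd : Even d) :
    IsGroebnerBasis d (fiveRelations K d) (idealSpan d {alpha K d}) where
  finite := by simp
  relation g hg := by
    obtain ⟨p, s, hgp⟩ := exists_basisElement hg
    exact hgp.isRelation hd
  span_eq := idealSpan_fiveRelations hd
  divides f hf hr := by
    obtain ⟨p, hp⟩ := exists_isLeadingMonomial hr.1
    refine ⟨p, hp, ?_⟩
    by_contra hcon
    have hno {g : LT K} {q : TTree} {s : List TTree} (hg : g ∈ fiveRelations K d)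
        (hgq : BasisElement K d g q s) : q.Occurs p = false := by
      rw [← Bool.not_eq_true, ← divides_iff_occurs]
      exact fun hdiv => hcon ⟨g, hg, q, hgq.isLeadingMonomial hd, hdiv⟩
    obtain ⟨i, hi⟩ := exists_tree_eq p (hno (by simp) .alpha) (hno (by simp) .beta)
      (hno (by simp) .eta) (hno (by simp) .theta) (hno (by simp) .nu)
    exact leadingMonomial_ne_tree hd hf hr hp i hi

theorem isReducedGroebnerBasis_fiveRelations [CharZero K] (hd : Even d) :
    IsReducedGroebnerBasis d (fiveRelations K d) (idealSpan d {alpha K d}) where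
  groebner := isGroebnerBasis_fiveRelations hd
  monic g hg p hp := by
    obtain ⟨q, s, hgq⟩ := exists_basisElement hg
    rw [hp.unique (hgq.isLeadingMonomial hd)]
    exact hgq.monic hd
  reduced g hg h hh hne q hq u hu := by
    obtain ⟨p, s, hgp⟩ := exists_basisElement hg
    obtain ⟨q', r, hhq⟩ := exists_basisElement hh
    rw [hq.unique (hhq.isLeadingMonomial hd)]
    exact hgp.not_divides hhq hne u (hgp.mem_list hd u hu)

theorem ncard_fiveRelations (hd : Even d) : (fiveRelations K d).ncard = 5 := by
  have ne {f g : LT K} {p q : TTree} (hf : IsLeadingMonomial f p) (hg : IsLeadingMonomial g q)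
      (h : p.path ≠ q.path) : f ≠ g := by
    rintro rfl
    exact h (congrArg path (hf.unique hg))
  have hα := isLeadingMonomial_alpha (K := K) hd
  have hβ := isLeadingMonomial_beta (K := K)
  have hη := isLeadingMonomial_eta (K := K)
  have hθ := isLeadingMonomial_theta (K := K)
  have hν := isLeadingMonomial_nu (K := K)
  rw [Set.ncard_insert_of_notMem, Set.ncard_insert_of_notMem, Set.ncard_insert_of_notMem,
    Set.ncard_insert_of_notMem, Set.ncard_singleton]
  all_goals simp only [Set.mem_insert_iff, Set.mem_singleton_iff, not_or]
  · exact ne hθ hν (by decide)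
  · exact ⟨ne hη hθ (by decide), ne hη hν (by decide)⟩
  · exact ⟨ne hβ hη (by decide), ne hβ hθ (by decide), ne hβ hν (by decide)⟩
  · exact ⟨ne hα hβ (by decide), ne hα hη (by decide), ne hα hθ (by decide), ne hα hν (by decide)⟩

end Main

end TernaryOperad

end

theorem theorem3p1 (K : Type*) [Field K] [CharZero K] (d : ℤ) (hd : Even d) :
    TernaryOperad.IsReducedGroebnerBasis d
      ({TernaryOperad.alpha K d, TernaryOperad.beta K, TernaryOperad.eta K,
        TernaryOperad.theta K, TernaryOperad.nu K} : Set (TernaryOperad.LT K))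
      (TernaryOperad.idealSpan d {TernaryOperad.alpha K d}) ∧
    (∀ G : Set (TernaryOperad.LT K),
      TernaryOperad.IsReducedGroebnerBasis d G
        (TernaryOperad.idealSpan d {TernaryOperad.alpha K d}) →
      G = {TernaryOperad.alpha K d, TernaryOperad.beta K, TernaryOperad.eta K,
        TernaryOperad.theta K, TernaryOperad.nu K}) ∧
    ({TernaryOperad.alpha K d, TernaryOperad.beta K, TernaryOperad.eta K,
        TernaryOperad.theta K, TernaryOperad.nu K} : Set (TernaryOperad.LT K)).ncard = 5 ∧
    TernaryOperad.IsLeadingMonomial (TernaryOperad.alpha K d) TernaryOperad.alphaLead ∧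
    TernaryOperad.IsLeadingMonomial (TernaryOperad.beta K) TernaryOperad.betaLead ∧
    TernaryOperad.IsLeadingMonomial (TernaryOperad.eta K) TernaryOperad.etaLead ∧
    TernaryOperad.IsLeadingMonomial (TernaryOperad.theta K) TernaryOperad.thetaLead ∧
    TernaryOperad.IsLeadingMonomial (TernaryOperad.nu K) TernaryOperad.nuLead := by
  have h := TernaryOperad.isReducedGroebnerBasis_fiveRelations (K := K) hd
  exact ⟨h, fun G hG => (hG.subset_of h).antisymm (h.subset_of hG),
    TernaryOperad.ncard_fiveRelations hd, TernaryOperad.isLeadingMonomial_alpha hd,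
    TernaryOperad.isLeadingMonomial_beta, TernaryOperad.isLeadingMonomial_eta,
    TernaryOperad.isLeadingMonomial_theta, TernaryOperad.isLeadingMonomial_nu⟩
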